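/- For real $p,q>0$ let $\mu_{p,q}(dx)=C_{p,q}(1-x)^{\frac{q-2}{2}}(1+x)^{\frac{p-2}{2}}dx$ on $[-1,1]$, where $C_{p,q}$ is the constant that makes $\mu_{p,q}$ a probability measure, and let $P_k^{p,q}$ ($k\ge 0$) be the Jacobi polynomials: $P_k^{p,q}$ has degree $k$ and positive leading coefficient, and $(P_k^{p,q})_{k\ge 0}$ is orthonormal in $L^2(\mu_{p,q})$. A sequence $\mathcal F=(f_0=1,f_1,f_2,\dots)$ of continuous real functions on a compact separable Hausdorff space $E$ that is an orthonormal basis of the real space $L^2(\mu)$ of a probability measure $\mu$ on $E$ has the hypergroup property at $x_0\in E$ if $f_i(x_0)\neq 0$ for all $i$ and, for every $x\in E$, there is a bounded operator $K_x$ on $L^2(\mu)$ with $K_x f_i=\frac{f_i(x)}{f_i(x_0)}f_i$ for all $i$ that is a Markov operator, i.e. $K_xg(y)=\int_E g(z)\,k_x(y,dz)$ for $\mu$-almost every $y$ and all $g\in L^2(\mu)$, for some kernel $k_x$ of probability measures on $E$. Theorem (Gasper). Let $p=q\ge 1$ or $q>p>1$. Then $(P_k^{p,q})_{k\ge0}$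 is an orthonormal basis of $L^2(\mu_{p,q})$ that has the hypergroup property at the point $1$. Moreover there is a kernel $m_{p,q}(x,y,dz)$ of Borel probability measures on $[-1,1]$, measurable in $(x,y)\in[-1,1]^2$, such that for all $k\ge 0$ and all $x,y\in[-1,1]$ $$\frac{P_k^{p,q}(x)\,P_k^{p,q}(y)}{P_k^{p,q}(1)}=\int_{[-1,1]} P_k^{p,q}(z)\,m_{p,q}(x,y,dz),$$ and, if $q>p>1$, the measure $m_{p,q}(x,y,\cdot)$ is absolutely continuous with respect to $\mu_{p,q}$ for all $x,y\in(-1,1)$. -/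

import Mathlib

open MeasureTheory ProbabilityTheory Polynomial

noncomputable section

/-! ## Unitary orthonormal bases, Markov sequences and the hypergroup property -/

section Hypergroup

variable {E : Type*} [TopologicalSpace E] [CompactSpace E] [MeasurableSpace E]

/-- `f = (f 0, f 1, …)` is a unitary orthonormal basis for `μ`: `μ` is a probability measure,
`f 0 = 1`, and the continuous functions `f i` form a Hilbert basis of the real space `L²(μ)`
(they are orthonormal, and a function of `L²(μ)` orthogonal to all of them vanishes). -/
structure IsUOB (μ : Measure E) (f : ℕ → C(E, ℝ)) : Prop where
  isProbabilityMeasure : IsProbabilityMeasure μ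
  zero_eq_one : f 0 = 1
  orthonormal : ∀ i j, ∫ x, f i x * f j x ∂μ = if i = j then 1 else 0
  complete : ∀ g : E → ℝ, MemLp g 2 μ → (∀ i, ∫ x, f i x * g x ∂μ = 0) → g =ᵐ[μ] 0

/-- A bounded operator `K` of `L²(μ)` is a Markov operator if it is given by a kernel `k` of
probability measures: `(K g)(x) = ∫ g(y) k(x, dy)` for `μ`-almost every `x`, for all
`g` in `L²(μ)`. -/
def IsMarkovOperator (μ : Measure E) (K : Lp ℝ 2 μ →L[ℝ] Lp ℝ 2 μ) : Prop :=
  ∃ k : Kernel E E, IsMarkovKernel k ∧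
    ∀ (g : E → ℝ) (hg : MemLp g 2 μ),
      ∀ᵐ x ∂μ, Integrable g (k x) ∧ K (hg.toLp g) x = ∫ y, g y ∂(k x)

/-- `l` is a Markov sequence for `f` if `f i ↦ l i • f i` defines a Markov operator. -/
def IsMarkovSequence (μ : Measure E) (f : ℕ → C(E, ℝ)) (l : ℕ → ℝ) : Prop :=
  ∃ K : Lp ℝ 2 μ →L[ℝ] Lp ℝ 2 μ, IsMarkovOperator μ K ∧
    ∀ i, ∃ hi : MemLp (f i) 2 μ, K (hi.toLp (f i)) = l i • hi.toLp (f i)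

/-- The hypergroup property of the unitary orthonormal basis `f` at the point `x₀`: for every `x`
the sequence `f i x / f i x₀` is a Markov sequence. -/
structure HasHypergroupProperty (μ : Measure E) (f : ℕ → C(E, ℝ)) (x₀ : E) : Prop where
  isUOB : IsUOB μ f
  ne_zero : ∀ i, f i x₀ ≠ 0
  isMarkovSequence : ∀ x, IsMarkovSequence μ f (fun i => f i x / f i x₀)

end Hypergroup

/-! ## Jacobi polynomials -/

/-- The interval `[-1, 1]`. -/
abbrev JacobiInterval : Type := Set.Icc (-1 : ℝ) 1

/-- The unnormalized measure `(1 - x)^((q-2)/2) (1 + x)^((p-2)/2) dx` on `[-1, 1]`. -/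
def jacobiWeightMeasure (p q : ℝ) : Measure JacobiInterval :=
  (Measure.comap (Subtype.val : JacobiInterval → ℝ) volume).withDensity fun x =>
    ENNReal.ofReal ((1 - (x : ℝ)) ^ ((q - 2) / 2) * (1 + (x : ℝ)) ^ ((p - 2) / 2))

/-- The probability measure `μ_{p,q} = C_{p,q} (1 - x)^((q-2)/2) (1 + x)^((p-2)/2) dx`
on `[-1, 1]`, for `p, q > 0`. -/
def jacobiMeasure (p q : ℝ) : Measure JacobiInterval :=
  (jacobiWeightMeasure p q Set.univ)⁻¹ • jacobiWeightMeasure p q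

/-- The monic orthogonal polynomials of `μ_{p,q}`, by Gram-Schmidt from `1, X, X², …`. -/
def jacobiMonic (p q : ℝ) (k : ℕ) : ℝ[X] :=
  X ^ k - ∑ j : Fin k,
    C ((∫ x : JacobiInterval, (x : ℝ) ^ k * (jacobiMonic p q j).eval (x : ℝ) ∂jacobiMeasure p q) /
        ∫ x : JacobiInterval, (jacobiMonic p q j).eval (x : ℝ) ^ 2 ∂jacobiMeasure p q) *
      jacobiMonic p q j
termination_by k
decreasing_by all_goals exact j.2

/-- The Jacobi polynomial `P_k^{p,q}`: the orthogonal polynomial of degree `k` of `μ_{p,q}`, with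
positive leading coefficient and norm `1` in `L²(μ_{p,q})`. -/
def jacobiPoly (p q : ℝ) (k : ℕ) : ℝ[X] :=
  C (√(∫ x : JacobiInterval, (jacobiMonic p q k).eval (x : ℝ) ^ 2 ∂jacobiMeasure p q))⁻¹ *
    jacobiMonic p q k

/-- `P_k^{p,q}` as a continuous function on `[-1, 1]`. -/
def jacobiFun (p q : ℝ) (k : ℕ) : C(JacobiInterval, ℝ) :=
  (jacobiPoly p q k).toContinuousMapOn (Set.Icc (-1 : ℝ) 1)

/-- The right end point `1` of `[-1, 1]`. -/
def jacobiOne : JacobiInterval := ⟨1, by norm_num, le_refl 1⟩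

end

noncomputable section

/-! ## Jacobi weights -/

/-! Write x = 2a² - 1 and y = 2d² - 1 with a² + b² = d² + e² = 1. Let ζ be a random point of the
unit disc with real part s and |ζ|² = t, and put Z = 2|ad + beζ|² - 1, a point of [-1, 1]. Here t =
(1 + ξ)/2 and s = √t c with ξ and c independent: ξ has law μ_{p,q-p} (or t = 1 if p = q), and c has
law μ_{p-1,p-1} (or c = ±1 with equal odds if p = 1). The law of Z is the required kernel, so
positivity is built in; what must be proved is the product formula.

Let T_y f(x) = E f(Z). On polynomials T_y commutes with the Jacobi operator L acting in x. Indeed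
the difference of the two sides is pointwise a combination of three weighted divergences on the
disc, along the radial, horizontal and rotational directions, and each has mean zero
(`ProductMoments.functional_radial`, `functional_horizontal`, `functional_angular`, combined in
`ProductMoments.intertwining`). These identities use only moment recursions of ξ and c, collected in
`ProductMoments`, so the atomic limiting cases need no separate argument.

Since odd powers of s have mean zero, T_y sends a polynomial of degree at most k to another one
(`ProductMoments.exists_translate`). Hence T_y P_k is an eigenvector of L of degree at most k with
the eigenvalue of P_k. The eigenvalues are distinct, so T_y P_k = c P_k. At x = 1 the variable Z is
the constant y, which gives c = P_k(y)/P_k(1).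

Integrating the product formula shows that the kernel leaves μ_{p,q} invariant; by Jensen it then
acts as a contraction of L², which gives the hypergroup property. Absolute continuity holds because,
for fixed ξ ≠ -1 and interior x and y, Z is affine in c with nonzero slope. -/

/-- The density of the Jacobi weight with respect to Lebesgue measure. -/
def jacobiDensity (p q x : ℝ) : ℝ := (1 - x) ^ ((q - 2) / 2) * (1 + x) ^ ((p - 2) / 2)

lemma measurable_jacobiDensity (p q : ℝ) : Measurable (jacobiDensity p q) := by
  unfold jacobiDensity; fun_prop

lemma jacobiDensity_nonneg (p q : ℝ) {x : ℝ} (hx : x ∈ Set.Icc (-1 : ℝ) 1) :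
    0 ≤ jacobiDensity p q x :=
  mul_nonneg (Real.rpow_nonneg (by linarith [hx.2]) _) (Real.rpow_nonneg (by linarith [hx.1]) _)

lemma jacobiDensity_pos (p q : ℝ) {x : ℝ} (hx : x ∈ Set.Ioo (-1 : ℝ) 1) :
    0 < jacobiDensity p q x :=
  mul_pos (Real.rpow_pos_of_pos (by linarith [hx.2]) _) (Real.rpow_pos_of_pos (by linarith
    [hx.1]) _)

/-- Only one factor is singular on each side of 0, with exponent above -1; the reflection x ↦ -x
exchanges the halves and swaps p and q. -/
lemma intervalIntegrable_jacobiDensity {p q : ℝ} (hp : 0 < p) (hq : 0 < q) :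
    IntervalIntegrable (jacobiDensity p q) volume (-1) 1 := by
  have key (r s : ℝ) (hr : 0 < r) : IntervalIntegrable
      (fun x : ℝ => (1 + x) ^ ((r - 2) / 2) * (1 - x) ^ ((s - 2) / 2)) volume (-1) 0 := by
    have h : IntervalIntegrable (fun x : ℝ => x ^ ((r - 2) / 2)) volume 0 1 :=
      intervalIntegral.intervalIntegrable_rpow' (by linarith)
    have h1 := h.comp_add_left 1
    norm_num at h1
    refine h1.mul_continuousOn ?_
    intro x hx
    rw [Set.uIcc_of_le (by norm_num)] at hx
    exact ((continuousAt_const.sub continuousAt_id).rpow_const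
      (Or.inl (by change (1 : ℝ) - x ≠ 0; linarith [hx.2]))).continuousWithinAt
  refine IntervalIntegrable.trans (b := 0) ?_ ?_
  · exact (key p q hp).congr (fun x _ => by simp [jacobiDensity, mul_comm])
  · have h := ((key q p hq).comp_sub_left 0).symm
    norm_num at h
    refine h.congr (fun x _ => ?_)
    simp [jacobiDensity, sub_eq_add_neg]

lemma jacobiWeightMeasure_eq (p q : ℝ) : jacobiWeightMeasure p q =
    (Measure.comap (Subtype.val : JacobiInterval → ℝ) volume).withDensity fun x =>
      ENNReal.ofReal (jacobiDensity p q x) := rfl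

lemma measurable_ofReal_jacobiDensity (p q : ℝ) : Measurable fun x : JacobiInterval =>
    ENNReal.ofReal (jacobiDensity p q x) :=
  ((measurable_jacobiDensity p q).comp measurable_subtype_coe).ennreal_ofReal

lemma isFiniteMeasure_jacobiWeightMeasure {p q : ℝ} (hp : 0 < p) (hq : 0 < q) :
    IsFiniteMeasure (jacobiWeightMeasure p q) := by
  rw [jacobiWeightMeasure_eq]
  refine isFiniteMeasure_withDensity_ofReal (Integrable.hasFiniteIntegral ?_)
  have h := (intervalIntegrable_iff_integrableOn_Icc_of_le (by norm_num)).1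
    (intervalIntegrable_jacobiDensity hp hq)
  exact (integrableOn_iff_comap_subtypeVal measurableSet_Icc).1 h

/-- The density can vanish only at the two end points, which are Lebesgue-null. -/
lemma volume_comap_absolutelyContinuous_jacobiWeightMeasure (p q : ℝ) :
    Measure.comap (Subtype.val : JacobiInterval → ℝ) volume ≪ jacobiWeightMeasure p q := by
  rw [jacobiWeightMeasure_eq]
  refine withDensity_absolutelyContinuous' (measurable_ofReal_jacobiDensity p q).aemeasurable ?_
  have h : ∀ᵐ x : ℝ, x ∈ Set.Icc (-1 : ℝ) 1 → x ∈ Set.Ioo (-1 : ℝ) 1 := by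
    have h1 : ∀ᵐ x : ℝ, x ≠ 1 := by simp [ae_iff]
    have h2 : ∀ᵐ x : ℝ, x ≠ -1 := by simp [ae_iff]
    filter_upwards [h1, h2] with x h1 h2 hx
    exact ⟨lt_of_le_of_ne hx.1 h2.symm, lt_of_le_of_ne hx.2 h1⟩
  rw [← ae_restrict_iff' measurableSet_Icc,
    ae_restrict_iff_subtype measurableSet_Icc] at h
  filter_upwards [h] with x hx
  exact (ENNReal.ofReal_pos.2 (jacobiDensity_pos p q hx)).ne'

lemma jacobiWeightMeasure_univ_ne_zero (p q : ℝ) : jacobiWeightMeasure p q Set.univ ≠ 0 := by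
  intro h
  have h1 := volume_comap_absolutelyContinuous_jacobiWeightMeasure p q h
  rw [comap_subtype_coe_apply measurableSet_Icc, Set.image_univ, Subtype.range_coe,
    Real.volume_Icc] at h1
  norm_num at h1

lemma isProbabilityMeasure_jacobiMeasure {p q : ℝ} (hp : 0 < p) (hq : 0 < q) :
    IsProbabilityMeasure (jacobiMeasure p q) := by
  have := isFiniteMeasure_jacobiWeightMeasure hp hq
  refine ⟨?_⟩
  rw [jacobiMeasure, Measure.smul_apply, smul_eq_mul]
  exact ENNReal.inv_mul_cancel (jacobiWeightMeasure_univ_ne_zero p q) (measure_ne_top _ _)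

lemma volume_comap_absolutelyContinuous_jacobiMeasure {p q : ℝ} (hp : 0 < p) (hq : 0 < q) :
    Measure.comap (Subtype.val : JacobiInterval → ℝ) volume ≪ jacobiMeasure p q := by
  have := isFiniteMeasure_jacobiWeightMeasure hp hq
  refine (volume_comap_absolutelyContinuous_jacobiWeightMeasure p q).trans ?_
  exact Measure.absolutelyContinuous_smul (ENNReal.inv_ne_zero.2 (measure_ne_top _ _))

lemma jacobiMeasure_absolutelyContinuous_volume_comap (p q : ℝ) :
    jacobiMeasure p q ≪ Measure.comap (Subtype.val : JacobiInterval → ℝ) volume :=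
  (Measure.smul_absolutelyContinuous).trans (withDensity_absolutelyContinuous _ _)

lemma integral_jacobiMeasure (p q : ℝ) (F : ℝ → ℝ) :
    ∫ x : JacobiInterval, F x ∂jacobiMeasure p q =
      ((jacobiWeightMeasure p q Set.univ)⁻¹).toReal *
        ∫ x in (-1 : ℝ)..1, jacobiDensity p q x * F x := by
  rw [jacobiMeasure, integral_smul_measure, smul_eq_mul, jacobiWeightMeasure_eq,
    integral_withDensity_eq_integral_toReal_smul (measurable_ofReal_jacobiDensity p q)
      (by simp), intervalIntegral.integral_of_le (by norm_num), ← integral_Icc_eq_integral_Ioc,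
    ← integral_subtype_comap measurableSet_Icc]
  congr 2
  ext x
  rw [ENNReal.toReal_ofReal (jacobiDensity_nonneg p q x.2), smul_eq_mul]

/-- The Jacobi operator in divergence form annihilates constants: integration by parts for the
Jacobi measure. -/
lemma integral_jacobiMeasure_deriv {p q : ℝ} (hp : 0 < p) (hq : 0 < q) (h : ℝ[X]) :
    ∫ x : JacobiInterval, ((1 - (x : ℝ) ^ 2) * h.derivative.eval (x : ℝ) +
      ((p - q) / 2 - (p + q) / 2 * x) * h.eval (x : ℝ)) ∂jacobiMeasure p q = 0 := by
  rw [integral_jacobiMeasure p q (fun x => (1 - x ^ 2) * h.derivative.eval x +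
      ((p - q) / 2 - (p + q) / 2 * x) * h.eval x)]
  -- The weight times the integrand is the derivative of (1 - x)^(q/2) (1 + x)^(p/2) h, which
  -- vanishes at both ends because p, q > 0.
  rw [intervalIntegral.integral_eq_sub_of_hasDerivAt_of_le (a := -1) (b := 1)
    (f := fun x => (1 - x) ^ (q / 2) * (1 + x) ^ (p / 2) * h.eval x)]
  · have h1 : q / 2 ≠ 0 := by positivity
    have h2 : p / 2 ≠ 0 := by positivity
    simp [h1, h2]
  · norm_num
  · refine ContinuousOn.mul (ContinuousOn.mul ?_ ?_) h.continuous.continuousOn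
    · exact (continuous_const.sub continuous_id).continuousOn.rpow_const
        (fun x _ => Or.inr (by positivity))
    · exact (continuous_const.add continuous_id).continuousOn.rpow_const
        (fun x _ => Or.inr (by positivity))
  · intro x hx
    have hx1 : 0 < 1 - x := by linarith [hx.2]
    have hx2 : 0 < 1 + x := by linarith [hx.1]
    have d1 : HasDerivAt (fun x : ℝ => (1 - x) ^ (q / 2)) _ x :=
      ((hasDerivAt_id x).const_sub 1).rpow_const (Or.inl hx1.ne')
    have d2 : HasDerivAt (fun x : ℝ => (1 + x) ^ (p / 2)) _ x :=
      ((hasDerivAt_id x).const_add 1).rpow_const (Or.inl hx2.ne')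
    refine ((d1.mul d2).mul (h.hasDerivAt x)).congr_deriv ?_
    have e1 : (1 - x) ^ (q / 2) = (1 - x) ^ ((q - 2) / 2) * (1 - x) := by
      rw [← Real.rpow_add_one hx1.ne']; congr 1; ring
    have e2 : (1 + x) ^ (p / 2) = (1 + x) ^ ((p - 2) / 2) * (1 + x) := by
      rw [← Real.rpow_add_one hx2.ne']; congr 1; ring
    have e3 : q / 2 - 1 = (q - 2) / 2 := by ring
    have e4 : p / 2 - 1 = (p - 2) / 2 := by ring
    simp only [id, Pi.mul_apply]
    rw [e1, e2, e3, e4, jacobiDensity]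
    ring
  · refine (intervalIntegrable_jacobiDensity hp hq).mul_continuousOn ?_
    fun_prop

/-- Makes (f, g) ↦ ∫ f g dμ positive definite on polynomials, as Gram-Schmidt requires. -/
lemma isOpenPosMeasure_jacobiMeasure {p q : ℝ} (hp : 0 < p) (hq : 0 < q) :
    (jacobiMeasure p q).IsOpenPosMeasure := by
  refine ⟨fun U hU hne h0 => ?_⟩
  have h1 := volume_comap_absolutelyContinuous_jacobiMeasure hp hq h0
  rw [comap_subtype_coe_apply measurableSet_Icc] at h1
  obtain ⟨V, hV, rfl⟩ := isOpen_induced_iff.1 hU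
  obtain ⟨x, hx⟩ := hne
  have hcl : (x : ℝ) ∈ closure (Set.Ioo (-1 : ℝ) 1) := by
    rw [closure_Ioo (by norm_num)]; exact x.2
  obtain ⟨y, hy1, hy2⟩ := mem_closure_iff.1 hcl V hV hx
  refine (((hV.inter isOpen_Ioo).measure_pos volume ⟨y, hy1, hy2⟩).trans_le
    (measure_mono ?_)).ne' h1
  rintro z ⟨hz1, hz2⟩
  exact ⟨⟨z, Set.Ioo_subset_Icc_self hz2⟩, hz1, rfl⟩

/-! ## Orthogonal polynomials of the Jacobi measure -/

lemma integrable_jacobiInterval {μ : Measure JacobiInterval} [IsFiniteMeasure μ]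
    {F : JacobiInterval → ℝ} (hF : Continuous F) : Integrable F μ := by
  simpa using hF.continuousOn.integrableOn_compact (μ := μ) isCompact_univ

/-- Integration of polynomials against a finite measure on `[-1, 1]`. -/
def polyIntegral (μ : Measure JacobiInterval) [IsFiniteMeasure μ] : ℝ[X] →ₗ[ℝ] ℝ where
  toFun f := ∫ x, f.eval (x : ℝ) ∂μ
  map_add' f g := by
    simp only [eval_add]
    exact integral_add (integrable_jacobiInterval (by fun_prop))
      (integrable_jacobiInterval (by fun_prop))
  map_smul' c f := by
    simp only [eval_smul, smul_eq_mul, RingHom.id_apply]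
    exact integral_const_mul _ _

lemma polyIntegral_apply (μ : Measure JacobiInterval) [IsFiniteMeasure μ] (f : ℝ[X]) :
    polyIntegral μ f = ∫ x, f.eval (x : ℝ) ∂μ := rfl

lemma eq_zero_of_polyIntegral_mul_self (μ : Measure JacobiInterval) [IsFiniteMeasure μ]
    [μ.IsOpenPosMeasure] {f : ℝ[X]} (hf : polyIntegral μ (f * f) = 0) : f = 0 := by
  rw [polyIntegral_apply] at hf
  have hc : Continuous fun x : JacobiInterval => (f * f).eval (x : ℝ) := by fun_prop
  rw [integral_eq_zero_iff_of_nonneg (fun x => by simp [mul_self_nonneg])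
    (integrable_jacobiInterval hc)] at hf
  have h0 := (Continuous.ae_eq_iff_eq μ hc (continuous_const (y := (0 : ℝ)))).1 hf
  refine eq_zero_of_infinite_isRoot f ((Set.Icc_infinite (by norm_num : (-1 : ℝ) < 1)).mono ?_)
  intro x hx
  have h1 := congrFun h0 ⟨x, hx⟩
  simpa using h1

lemma polyIntegral_mul_self_pos (μ : Measure JacobiInterval) [IsFiniteMeasure μ]
    [μ.IsOpenPosMeasure] {f : ℝ[X]} (hf : f ≠ 0) : 0 < polyIntegral μ (f * f) := by
  refine lt_of_le_of_ne ?_ (fun h => hf (eq_zero_of_polyIntegral_mul_self μ h.symm))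
  exact integral_nonneg fun x => by simp [mul_self_nonneg]

lemma jacobiMonic_eq (p q : ℝ) (k : ℕ) [IsFiniteMeasure (jacobiMeasure p q)] :
    jacobiMonic p q k = X ^ k - ∑ j : Fin k,
      C (polyIntegral (jacobiMeasure p q) (X ^ k * jacobiMonic p q j) /
        polyIntegral (jacobiMeasure p q) (jacobiMonic p q j * jacobiMonic p q j)) *
          jacobiMonic p q j := by
  rw [jacobiMonic]
  simp [polyIntegral_apply, pow_two]

lemma monic_natDegree_jacobiMonic (p q : ℝ) (k : ℕ) :
    (jacobiMonic p q k).Monic ∧ (jacobiMonic p q k).natDegree = k := by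
  induction k using Nat.strong_induction_on with
  | _ k ih =>
    rw [jacobiMonic]
    have key (c : Fin k → ℝ) :
        (∑ j : Fin k, C (c j) * jacobiMonic p q j).degree < ((X : ℝ[X]) ^ k).degree := by
      rw [degree_X_pow]
      refine (degree_sum_le _ _).trans_lt ((Finset.sup_lt_iff (WithBot.bot_lt_coe k)).2 ?_)
      intro j _
      rw [← smul_eq_C_mul]
      refine (degree_smul_le _ _).trans_lt ?_
      rw [degree_eq_natDegree (ih j j.2).1.ne_zero, (ih j j.2).2]
      exact WithBot.coe_lt_coe.2 j.2
    refine ⟨(monic_X_pow k).sub_of_left (key _), ?_⟩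
    rw [natDegree_eq_of_degree_eq (degree_sub_eq_left_of_degree_lt (key _)), natDegree_X_pow]

lemma coeff_jacobiMonic_self (p q : ℝ) (k : ℕ) : (jacobiMonic p q k).coeff k = 1 := by
  have h := (monic_natDegree_jacobiMonic p q k).1.coeff_natDegree
  rwa [(monic_natDegree_jacobiMonic p q k).2] at h

lemma degree_sub_C_mul_jacobiMonic_lt (p q : ℝ) {n : ℕ} {f : ℝ[X]} (hf : f.natDegree ≤ n) :
    (f - C (f.coeff n) * jacobiMonic p q n).degree < n := by
  rw [degree_lt_iff_coeff_zero]
  intro m hm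
  rcases hm.eq_or_lt with rfl | hm
  · simp [coeff_jacobiMonic_self]
  · rw [coeff_sub, coeff_C_mul, coeff_eq_zero_of_natDegree_lt (hf.trans_lt hm),
      coeff_eq_zero_of_natDegree_lt ((monic_natDegree_jacobiMonic p q n).2.trans_lt hm)]
    simp

section Orthogonality

variable {p q : ℝ} [IsFiniteMeasure (jacobiMeasure p q)] [(jacobiMeasure p q).IsOpenPosMeasure]

lemma polyIntegral_jacobiMonic_mul_of_lt (k : ℕ) : ∀ j < k,
    polyIntegral (jacobiMeasure p q) (jacobiMonic p q k * jacobiMonic p q j) = 0 := by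
  induction k using Nat.strong_induction_on with
  | _ k ih =>
    intro j hj
    have hpos := polyIntegral_mul_self_pos (jacobiMeasure p q)
      (monic_natDegree_jacobiMonic p q j).1.ne_zero
    rw [jacobiMonic_eq p q k, sub_mul, map_sub, Finset.sum_mul, map_sum,
      Finset.sum_eq_single ⟨j, hj⟩]
    · rw [mul_assoc, ← smul_eq_C_mul, map_smul, smul_eq_mul, div_mul_cancel₀ _ hpos.ne', sub_self]
    · intro i _ hij
      rw [mul_assoc, ← smul_eq_C_mul, map_smul]
      have hne : (i : ℕ) ≠ j := fun h => hij (Fin.ext h)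
      rcases hne.lt_or_gt with h | h
      · rw [mul_comm (jacobiMonic p q i) (jacobiMonic p q j), ih j hj i h, smul_zero]
      · rw [ih i i.2 j h, smul_zero]
    · simp

/-- The induction on n, with k fixed, strips the top coefficient of f by subtracting a multiple of a
lower orthogonal polynomial. -/
lemma polyIntegral_jacobiMonic_mul_of_degree_lt (k : ℕ) : ∀ n ≤ k, ∀ f : ℝ[X], f.degree < n →
    polyIntegral (jacobiMeasure p q) (jacobiMonic p q k * f) = 0 := by
  intro n
  induction n with
  | zero =>
    intro _ f hf
    have : f = 0 := by simpa [Nat.cast_zero] using hf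
    simp [this]
  | succ n ih =>
    intro hn f hf
    have hf' : f.natDegree ≤ n := natDegree_le_of_degree_le (by
      rw [← Order.lt_succ_iff]; exact_mod_cast hf)
    have h1 := ih (by omega) _ (degree_sub_C_mul_jacobiMonic_lt p q hf')
    rw [mul_sub, map_sub, mul_left_comm, ← smul_eq_C_mul, map_smul,
      polyIntegral_jacobiMonic_mul_of_lt k n (by omega), smul_zero, sub_zero] at h1
    exact h1

end Orthogonality

/-! ## The Jacobi operator -/

/-- The Jacobi differential operator on polynomials. -/
def jacobiOp (p q : ℝ) (f : ℝ[X]) : ℝ[X] :=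
  (1 - X ^ 2) * derivative (derivative f) +
    (C ((p - q) / 2) - C ((p + q) / 2) * X) * derivative f

/-- The eigenvalues of the Jacobi operator, up to sign. -/
def jacobiEigenvalue (p q : ℝ) (k : ℕ) : ℝ := k * (k - 1 + (p + q) / 2)

lemma jacobiOp_add (p q : ℝ) (f g : ℝ[X]) :
    jacobiOp p q (f + g) = jacobiOp p q f + jacobiOp p q g := by
  simp only [jacobiOp, derivative_add]; ring

lemma jacobiOp_C_mul (p q c : ℝ) (f : ℝ[X]) : jacobiOp p q (C c * f) = C c * jacobiOp p q f := by
  simp only [jacobiOp, derivative_C_mul]; ring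

lemma jacobiEigenvalue_strictMono {p q : ℝ} (h : 2 ≤ p + q) {m k : ℕ} (hmk : m < k) :
    jacobiEigenvalue p q m < jacobiEigenvalue p q k := by
  have h1 : (m : ℝ) + 1 ≤ k := by exact_mod_cast hmk
  have h2 : (0 : ℝ) ≤ m := m.cast_nonneg
  unfold jacobiEigenvalue
  nlinarith

lemma coeff_jacobiOp (p q : ℝ) (f : ℝ[X]) (k : ℕ) :
    (jacobiOp p q f).coeff k = (derivative (derivative f)).coeff k +
      (p - q) / 2 * (derivative f).coeff k - jacobiEigenvalue p q k * f.coeff k := by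
  have e : jacobiOp p q f = derivative (derivative f) - X ^ 2 * derivative (derivative f) +
      (C ((p - q) / 2) * derivative f - C ((p + q) / 2) * (X * derivative f)) := by
    unfold jacobiOp; ring
  rw [e]
  simp only [coeff_add, coeff_sub, coeff_C_mul]
  rcases k with _ | _ | k
  · simp [jacobiEigenvalue]
  · simp [coeff_X_pow_mul', jacobiEigenvalue, coeff_X_mul, coeff_derivative]
    ring
  · simp only [coeff_X_pow_mul', coeff_X_mul, jacobiEigenvalue, coeff_derivative]
    simp
    ring

/-- L is triangular in the monomial basis, with the negated eigenvalues on the diagonal. -/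
lemma coeff_jacobiOp_of_natDegree_le (p q : ℝ) {f : ℝ[X]} {k : ℕ} (hf : f.natDegree ≤ k) :
    (jacobiOp p q f).coeff k = - jacobiEigenvalue p q k * f.coeff k := by
  rw [coeff_jacobiOp, coeff_derivative, coeff_derivative, coeff_derivative,
    coeff_eq_zero_of_natDegree_lt (show f.natDegree < k + 1 + 1 by omega),
    coeff_eq_zero_of_natDegree_lt (show f.natDegree < k + 1 by omega)]
  ring

lemma degree_jacobiOp_lt (p q : ℝ) {f : ℝ[X]} {k : ℕ} (hf : f.degree < k) :
    (jacobiOp p q f).degree < k := by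
  rw [degree_lt_iff_coeff_zero] at hf ⊢
  intro m hm
  rw [coeff_jacobiOp, coeff_derivative, coeff_derivative, coeff_derivative, hf m hm,
    hf (m + 1) (by omega), hf (m + 1 + 1) (by omega)]
  ring

/-- Both sides equal the symmetric form -∫ (1 - x²) f' g' dμ. -/
lemma polyIntegral_jacobiOp_mul {p q : ℝ} (hp : 0 < p) (hq : 0 < q)
    [IsFiniteMeasure (jacobiMeasure p q)] (f g : ℝ[X]) :
    polyIntegral (jacobiMeasure p q) (jacobiOp p q f * g) =
      polyIntegral (jacobiMeasure p q) (f * jacobiOp p q g) := by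
  have key (f g : ℝ[X]) : polyIntegral (jacobiMeasure p q) (jacobiOp p q f * g) =
      - polyIntegral (jacobiMeasure p q) ((1 - X ^ 2) * derivative f * derivative g) := by
    rw [eq_neg_iff_add_eq_zero, ← map_add, polyIntegral_apply]
    refine Eq.trans ?_ (integral_jacobiMeasure_deriv hp hq (derivative f * g))
    congr 1
    ext x
    simp only [jacobiOp, derivative_mul, eval_add, eval_mul, eval_sub, eval_C, eval_X, eval_pow,
      eval_one]
    ring
  rw [key f g, mul_comm f, key g f]
  congr 2
  ring

/-- The defect R has degree below k since the top coefficients cancel. It is also orthogonal to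
every polynomial of degree below k, since L is symmetric and does not raise degrees. So R is
orthogonal to itself. -/
lemma jacobiOp_jacobiMonic {p q : ℝ} (hp : 0 < p) (hq : 0 < q) (k : ℕ) :
    jacobiOp p q (jacobiMonic p q k) = - C (jacobiEigenvalue p q k) * jacobiMonic p q k := by
  have := isProbabilityMeasure_jacobiMeasure hp hq
  have := isOpenPosMeasure_jacobiMeasure hp hq
  rw [neg_mul, eq_neg_iff_add_eq_zero]
  set R := jacobiOp p q (jacobiMonic p q k) + C (jacobiEigenvalue p q k) * jacobiMonic p q k
    with hR
  have hdeg := (monic_natDegree_jacobiMonic p q k).2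
  have hRd : R.degree < k := by
    rw [degree_lt_iff_coeff_zero]
    intro m hm
    rw [hR, coeff_add, coeff_C_mul]
    rcases hm.eq_or_lt with rfl | hm
    · rw [coeff_jacobiOp_of_natDegree_le p q hdeg.le]; ring
    · rw [coeff_jacobiOp_of_natDegree_le p q (hdeg.trans_le hm.le),
        coeff_eq_zero_of_natDegree_lt (hdeg.trans_lt hm)]
      ring
  refine eq_zero_of_polyIntegral_mul_self (jacobiMeasure p q) ?_
  nth_rewrite 1 [hR]
  rw [add_mul, map_add, polyIntegral_jacobiOp_mul hp hq,
    polyIntegral_jacobiMonic_mul_of_degree_lt k k le_rfl _ (degree_jacobiOp_lt p q hRd),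
    mul_assoc, ← smul_eq_C_mul, map_smul,
    polyIntegral_jacobiMonic_mul_of_degree_lt k k le_rfl _ hRd]
  simp

/-- Subtracting the multiple with the same top coefficient leaves an eigenvector R of degree below
k. If R ≠ 0, its leading coefficient forces two distinct eigenvalues to agree. -/
lemma eq_C_mul_jacobiMonic_of_jacobiOp {p q : ℝ} (hp : 1 ≤ p) (hq : 1 ≤ q) {k : ℕ} {H : ℝ[X]}
    (hH : H.natDegree ≤ k) (hL : jacobiOp p q H = - C (jacobiEigenvalue p q k) * H) :
    H = C (H.coeff k) * jacobiMonic p q k := by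
  have hR := degree_sub_C_mul_jacobiMonic_lt p q hH
  rw [← sub_eq_zero]
  set R := H - C (H.coeff k) * jacobiMonic p q k with hRdef
  have hLR : jacobiOp p q R = - C (jacobiEigenvalue p q k) * R := by
    have e : R = H + C (- H.coeff k) * jacobiMonic p q k := by rw [hRdef, C_neg]; ring
    rw [e, jacobiOp_add, jacobiOp_C_mul, hL, jacobiOp_jacobiMonic (by linarith) (by linarith)]
    ring
  by_contra hne
  have hlt : R.natDegree < k := (natDegree_lt_iff_degree_lt hne).2 hR
  have h1 := coeff_jacobiOp_of_natDegree_le p q (le_refl R.natDegree)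
  rw [hLR, ← C_neg, coeff_C_mul] at h1
  have h2 := mul_right_cancel₀ (leadingCoeff_ne_zero.2 hne) h1
  have h3 := jacobiEigenvalue_strictMono (show 2 ≤ p + q by linarith) hlt
  linarith

/-! ## Normalized Jacobi polynomials -/

section Normalized

variable {p q : ℝ}

lemma jacobiPoly_eq [IsFiniteMeasure (jacobiMeasure p q)] (k : ℕ) : jacobiPoly p q k =
    C (√(polyIntegral (jacobiMeasure p q) (jacobiMonic p q k * jacobiMonic p q k)))⁻¹ *
      jacobiMonic p q k := by
  simp [jacobiPoly, polyIntegral_apply, pow_two]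

lemma exists_jacobiPoly_eq (hp : 0 < p) (hq : 0 < q) (k : ℕ) :
    ∃ c : ℝ, 0 < c ∧ jacobiPoly p q k = C c * jacobiMonic p q k := by
  have := isProbabilityMeasure_jacobiMeasure hp hq
  have := isOpenPosMeasure_jacobiMeasure hp hq
  exact ⟨_, inv_pos.2 (Real.sqrt_pos.2 (polyIntegral_mul_self_pos (jacobiMeasure p q)
    (monic_natDegree_jacobiMonic p q k).1.ne_zero)), jacobiPoly_eq k⟩

lemma natDegree_jacobiPoly (hp : 0 < p) (hq : 0 < q) (k : ℕ) :
    (jacobiPoly p q k).natDegree = k := by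
  obtain ⟨c, hc, h⟩ := exists_jacobiPoly_eq hp hq k
  rw [h, natDegree_C_mul hc.ne', (monic_natDegree_jacobiMonic p q k).2]

lemma jacobiPoly_ne_zero (hp : 0 < p) (hq : 0 < q) (k : ℕ) : jacobiPoly p q k ≠ 0 := by
  obtain ⟨c, hc, h⟩ := exists_jacobiPoly_eq hp hq k
  rw [h]
  exact mul_ne_zero (C_ne_zero.2 hc.ne') (monic_natDegree_jacobiMonic p q k).1.ne_zero

lemma jacobiOp_jacobiPoly (hp : 0 < p) (hq : 0 < q) (k : ℕ) :
    jacobiOp p q (jacobiPoly p q k) = - C (jacobiEigenvalue p q k) * jacobiPoly p q k := by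
  obtain ⟨c, hc, h⟩ := exists_jacobiPoly_eq hp hq k
  rw [h, jacobiOp_C_mul, jacobiOp_jacobiMonic hp hq]
  ring

lemma eq_C_mul_jacobiPoly_of_jacobiOp (hp : 1 ≤ p) (hq : 1 ≤ q) {k : ℕ} {H : ℝ[X]}
    (hH : H.natDegree ≤ k) (hL : jacobiOp p q H = - C (jacobiEigenvalue p q k) * H) :
    ∃ c : ℝ, H = C c * jacobiPoly p q k := by
  obtain ⟨c, hc, h⟩ := exists_jacobiPoly_eq (by linarith : 0 < p) (by linarith : 0 < q) k
  refine ⟨H.coeff k / c, ?_⟩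
  rw [h, ← mul_assoc, ← C_mul, div_mul_cancel₀ _ hc.ne']
  exact eq_C_mul_jacobiMonic_of_jacobiOp hp hq hH hL

lemma polyIntegral_jacobiPoly_mul (hp : 0 < p) (hq : 0 < q)
    [IsFiniteMeasure (jacobiMeasure p q)] (i j : ℕ) :
    polyIntegral (jacobiMeasure p q) (jacobiPoly p q i * jacobiPoly p q j) =
      if i = j then 1 else 0 := by
  have := isOpenPosMeasure_jacobiMeasure hp hq
  have e (a b : ℝ) (f g : ℝ[X]) : polyIntegral (jacobiMeasure p q) (C a * f * (C b * g)) =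
      a * b * polyIntegral (jacobiMeasure p q) (f * g) := by
    rw [show C a * f * (C b * g) = C (a * b) * (f * g) by rw [C_mul]; ring, ← smul_eq_C_mul,
      map_smul, smul_eq_mul]
  rw [jacobiPoly_eq, jacobiPoly_eq, e]
  split_ifs with h
  · subst h
    have hpos := polyIntegral_mul_self_pos (jacobiMeasure p q)
      (monic_natDegree_jacobiMonic p q i).1.ne_zero
    rw [← mul_inv, Real.mul_self_sqrt hpos.le, inv_mul_cancel₀ hpos.ne']
  · rcases lt_or_gt_of_ne h with h | h
    · rw [mul_comm (jacobiMonic p q i) (jacobiMonic p q j), polyIntegral_jacobiMonic_mul_of_lt j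
      i h, mul_zero]
    · rw [polyIntegral_jacobiMonic_mul_of_lt i j h, mul_zero]

end Normalized

/-! ## The product functional -/

/-- The pair of measures `ρ`, `η` on `[-1, 1]` has the moments of the radial and angular parts of
the product formula with parameters `p`, `q`. -/
structure ProductMoments (p q : ℝ) (ρ η : Measure JacobiInterval) : Prop where
  radial : ∀ j : ℕ, (j + p / 2) * ∫ x : JacobiInterval, ((1 + (x : ℝ)) / 2) ^ j *
    (1 - (1 + (x : ℝ)) / 2) ∂ρ = (q - p) / 2 * ∫ x : JacobiInterval, ((1 + (x : ℝ)) / 2) ^ (j +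
      1) ∂ρ
  angular_one : ∫ x : JacobiInterval, (x : ℝ) ∂η = 0
  angular : ∀ l : ℕ, (l + 1) * ∫ x : JacobiInterval, (x : ℝ) ^ l ∂η =
    (l + p) * ∫ x : JacobiInterval, (x : ℝ) ^ (l + 2) ∂η

lemma ProductMoments.angular_odd {p q : ℝ} {ρ η : Measure JacobiInterval}
    (hp : 0 < p) (h : ProductMoments p q ρ η) (l : ℕ) :
    ∫ x : JacobiInterval, (x : ℝ) ^ (2 * l + 1) ∂η = 0 := by
  induction l with
  | zero => simpa using h.angular_one
  | succ l ih =>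
    have h1 := h.angular (2 * l + 1)
    rw [ih, mul_zero] at h1
    have h2 : (0 : ℝ) < ((2 * l + 1 : ℕ) : ℝ) + p := by positivity
    exact (mul_eq_zero.1 h1.symm).resolve_left h2.ne'

/-- The squared radius `t`. -/
def radSq (ω : JacobiInterval × JacobiInterval) : ℝ := (1 + (ω.1 : ℝ)) / 2

/-- The abscissa `s = √t c`. -/
def absc (ω : JacobiInterval × JacobiInterval) : ℝ := √((1 + (ω.1 : ℝ)) / 2) * ω.2

lemma radSq_nonneg (ω : JacobiInterval × JacobiInterval) : 0 ≤ radSq ω := by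
  have := ω.1.2.1; unfold radSq; linarith

lemma radSq_le_one (ω : JacobiInterval × JacobiInterval) : radSq ω ≤ 1 := by
  have := ω.1.2.2; unfold radSq; linarith

lemma absc_sq_le (ω : JacobiInterval × JacobiInterval) : absc ω ^ 2 ≤ radSq ω := by
  have h := radSq_nonneg ω
  unfold radSq at h ⊢
  unfold absc
  rw [mul_pow, Real.sq_sqrt h]
  have := ω.2.2.1
  have := ω.2.2.2
  exact mul_le_of_le_one_right h (by nlinarith)

@[fun_prop] lemma continuous_radSq : Continuous radSq := by unfold radSq; fun_prop

@[fun_prop] lemma continuous_absc : Continuous absc := by unfold absc; fun_prop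

lemma integrable_of_continuous_compact {Ω : Type*} [TopologicalSpace Ω] [CompactSpace Ω]
    [MeasurableSpace Ω] [OpensMeasurableSpace Ω] {μ : Measure Ω} [IsFiniteMeasure μ] {F : Ω → ℝ}
    (hF : Continuous F) : Integrable F μ := by
  obtain ⟨C, hC⟩ := isCompact_univ.exists_bound_of_continuousOn hF.continuousOn
  exact Integrable.of_bound hF.measurable.aestronglyMeasurable C
    (Filter.Eventually.of_forall fun x => hC x trivial)

section Functional

variable (ρ η : Measure JacobiInterval) [IsProbabilityMeasure ρ] [IsProbabilityMeasure η]

lemma continuous_eval_absc_radSq (h : MvPolynomial (Fin 2) ℝ) :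
    Continuous fun ω => MvPolynomial.eval ![absc ω, radSq ω] h := by
  refine (MvPolynomial.continuous_eval h).comp (continuous_pi fun i => ?_)
  fin_cases i
  · exact continuous_absc
  · exact continuous_radSq

/-- The expectation of a polynomial in `s` (variable `0`) and `t` (variable `1`). -/
def prodFunctional : MvPolynomial (Fin 2) ℝ →ₗ[ℝ] ℝ where
  toFun h := ∫ ω, MvPolynomial.eval ![absc ω, radSq ω] h ∂(ρ.prod η)
  map_add' f g := by
    simp only [map_add]
    exact integral_add (integrable_of_continuous_compact (continuous_eval_absc_radSq f))
      (integrable_of_continuous_compact (continuous_eval_absc_radSq g))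
  map_smul' c f := by
    simp only [MvPolynomial.smul_eval, RingHom.id_apply, smul_eq_mul]
    exact integral_const_mul _ _

lemma prodFunctional_apply (h : MvPolynomial (Fin 2) ℝ) : prodFunctional ρ η h =
    ∫ ω, MvPolynomial.eval ![absc ω, radSq ω] h ∂(ρ.prod η) := rfl

lemma prodFunctional_C_mul (c : ℝ) (h : MvPolynomial (Fin 2) ℝ) :
    prodFunctional ρ η (MvPolynomial.C c * h) = c * prodFunctional ρ η h := by
  rw [← MvPolynomial.smul_eq_C_mul, map_smul, smul_eq_mul]

/-- The moments of the product functional. -/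
def prodMoment (i j : ℕ) : ℝ := prodFunctional ρ η (MvPolynomial.X 0 ^ i * MvPolynomial.X 1 ^ j)

lemma prodMoment_eq (i j : ℕ) : prodMoment ρ η i j =
    (∫ x : JacobiInterval, √((1 + (x : ℝ)) / 2) ^ i * ((1 + (x : ℝ)) / 2) ^ j ∂ρ) *
      ∫ x : JacobiInterval, (x : ℝ) ^ i ∂η := by
  rw [← integral_prod_mul, prodMoment, prodFunctional_apply]
  congr 1
  ext ω
  simp [absc, radSq]
  ring

lemma prodFunctional_X_pow_mul (i j : ℕ) :
    prodFunctional ρ η (MvPolynomial.X 0 ^ i * MvPolynomial.X 1 ^ j) = prodMoment ρ η i j := rfl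

variable {ρ η} {p q : ℝ}

lemma ProductMoments.prodMoment_odd (hp : 0 < p) (h : ProductMoments p q ρ η) (l j : ℕ) :
    prodMoment ρ η (2 * l + 1) j = 0 := by
  rw [prodMoment_eq, h.angular_odd hp, mul_zero]

lemma ProductMoments.prodMoment_angular (h : ProductMoments p q ρ η) (i j : ℕ) :
    (i + 1) * prodMoment ρ η i (j + 1) = (i + p) * prodMoment ρ η (i + 2) j := by
  have e : ∫ x : JacobiInterval, √((1 + (x : ℝ)) / 2) ^ (i + 2) * ((1 + (x : ℝ)) / 2) ^ j ∂ρ =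
      ∫ x : JacobiInterval, √((1 + (x : ℝ)) / 2) ^ i * ((1 + (x : ℝ)) / 2) ^ (j + 1) ∂ρ := by
    congr 1
    ext x
    have hx : 0 ≤ (1 + (x : ℝ)) / 2 := by have := x.2.1; linarith
    rw [pow_add, Real.sq_sqrt hx]
    ring
  rw [prodMoment_eq, prodMoment_eq, e]
  linear_combination (∫ x : JacobiInterval, √((1 + (x : ℝ)) / 2) ^ i *
    ((1 + (x : ℝ)) / 2) ^ (j + 1) ∂ρ) * h.angular i

/-- For odd i every moment vanishes by symmetry of c; for even i = 2l the power √t^i is t^l, and the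
one-variable recursion applies at l + j. -/
lemma ProductMoments.prodMoment_radial (hp : 0 < p) (h : ProductMoments p q ρ η) (i j : ℕ) :
    (i / 2 + j + p / 2) * (prodMoment ρ η i j - prodMoment ρ η i (j + 1)) =
      (q - p) / 2 * prodMoment ρ η i (j + 1) := by
  rcases Nat.even_or_odd' i with ⟨l, rfl | rfl⟩
  · have e (j : ℕ) : ∫ x : JacobiInterval, √((1 + (x : ℝ)) / 2) ^ (2 * l) *
        ((1 + (x : ℝ)) / 2) ^ j ∂ρ = ∫ x : JacobiInterval, ((1 + (x : ℝ)) / 2) ^ (l + j) ∂ρ := by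
      congr 1
      ext x
      have hx : 0 ≤ (1 + (x : ℝ)) / 2 := by have := x.2.1; linarith
      rw [pow_mul, Real.sq_sqrt hx, pow_add]
    have h1 := h.radial (l + j)
    have h2 : ∫ x : JacobiInterval, ((1 + (x : ℝ)) / 2) ^ (l + j) * (1 - (1 + (x : ℝ)) / 2) ∂ρ =
        (∫ x : JacobiInterval, ((1 + (x : ℝ)) / 2) ^ (l + j) ∂ρ) -
          ∫ x : JacobiInterval, ((1 + (x : ℝ)) / 2) ^ (l + (j + 1)) ∂ρ := by
      rw [← integral_sub (integrable_jacobiInterval (by fun_prop))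
        (integrable_jacobiInterval (by fun_prop))]
      congr 1
      ext x
      ring
    rw [h2] at h1
    simp only [prodMoment_eq, e]
    push_cast at h1 ⊢
    rw [← add_assoc] at h1 ⊢
    linear_combination (∫ x : JacobiInterval, (x : ℝ) ^ (2 * l) ∂η) * h1
  · simp [h.prodMoment_odd hp]

/-- Integration by parts along the field `(t - s²) ∂_s`. -/
lemma ProductMoments.functional_angular (hp : 0 < p) (hM : ProductMoments p q ρ η)
    (h : MvPolynomial (Fin 2) ℝ) :
    prodFunctional ρ η ((MvPolynomial.X 1 - MvPolynomial.X 0 ^ 2) * MvPolynomial.pderiv 0 h -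
      MvPolynomial.C (p - 1) * MvPolynomial.X 0 * h) = 0 := by
  induction h using MvPolynomial.induction_on' with
  | add f g hf hg =>
    refine Eq.trans ?_ (((map_add (prodFunctional ρ η) _ _).trans
      (congrArg₂ (· + ·) hf hg)).trans (add_zero 0))
    congr 1
    simp only [map_add]
    ring
  | monomial u a =>
    rw [MvPolynomial.monomial_eq, Finsupp.prod_fintype _ _ (by simp), Fin.prod_univ_two]
    generalize u 0 = i
    generalize u 1 = j
    rcases i with _ | l
    -- With no power of s the derivative ∂_s vanishes, and only a first-order, hence odd, moment in
    -- s remains.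
    · have h1 := hM.prodMoment_odd hp 0 j
      rw [prodMoment] at h1
      have e : (MvPolynomial.X 1 - MvPolynomial.X 0 ^ 2) * MvPolynomial.pderiv 0
          (MvPolynomial.C a * (MvPolynomial.X 0 ^ 0 * MvPolynomial.X 1 ^ j)) -
          MvPolynomial.C (p - 1) * MvPolynomial.X 0 *
            (MvPolynomial.C a * (MvPolynomial.X 0 ^ 0 * MvPolynomial.X 1 ^ j)) =
          MvPolynomial.C (-(p - 1) * a) *
            (MvPolynomial.X (0 : Fin 2) ^ (2 * 0 + 1) * MvPolynomial.X 1 ^ j) := by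
        simp [Derivation.leibniz, Derivation.leibniz_pow, MvPolynomial.pderiv_X]
        ring
      rw [e, prodFunctional_C_mul, h1, mul_zero]
    · have h1 := hM.prodMoment_angular l j
      have e : (MvPolynomial.X 1 - MvPolynomial.X 0 ^ 2) * MvPolynomial.pderiv 0
          (MvPolynomial.C a * (MvPolynomial.X 0 ^ (l + 1) * MvPolynomial.X 1 ^ j)) -
          MvPolynomial.C (p - 1) * MvPolynomial.X 0 *
            (MvPolynomial.C a * (MvPolynomial.X 0 ^ (l + 1) * MvPolynomial.X 1 ^ j)) =
          MvPolynomial.C (a * (l + 1)) *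
            (MvPolynomial.X (0 : Fin 2) ^ l * MvPolynomial.X 1 ^ (j + 1)) -
          MvPolynomial.C (a * (l + p)) *
            (MvPolynomial.X (0 : Fin 2) ^ (l + 2) * MvPolynomial.X 1 ^ j) := by
        simp [Derivation.leibniz, Derivation.leibniz_pow, MvPolynomial.pderiv_X]
        ring
      rw [e, map_sub, prodFunctional_C_mul, prodFunctional_C_mul, prodFunctional_X_pow_mul,
        prodFunctional_X_pow_mul]
      linear_combination a * h1

/-- Integration by parts along the field `(1 - t) (t ∂_t + s/2 ∂_s)`. -/
lemma ProductMoments.functional_radial (hp : 0 < p) (hM : ProductMoments p q ρ η)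
    (h : MvPolynomial (Fin 2) ℝ) :
    prodFunctional ρ η ((1 - MvPolynomial.X 1) * (MvPolynomial.X 1 * MvPolynomial.pderiv 1 h +
        MvPolynomial.C (1 / 2) * MvPolynomial.X 0 * MvPolynomial.pderiv 0 h) +
      (MvPolynomial.C (p / 2) - MvPolynomial.C (q / 2) * MvPolynomial.X 1) * h) = 0 := by
  induction h using MvPolynomial.induction_on' with
  | add f g hf hg =>
    refine Eq.trans ?_ (((map_add (prodFunctional ρ η) _ _).trans
      (congrArg₂ (· + ·) hf hg)).trans (add_zero 0))
    congr 1
    simp only [map_add]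
    ring
  | monomial u a =>
    rw [MvPolynomial.monomial_eq, Finsupp.prod_fintype _ _ (by simp), Fin.prod_univ_two]
    generalize u 0 = i
    generalize u 1 = j
    have h1 := hM.prodMoment_radial hp i j
    have e : (1 - MvPolynomial.X 1) * (MvPolynomial.X 1 * MvPolynomial.pderiv 1
          (MvPolynomial.C a * (MvPolynomial.X 0 ^ i * MvPolynomial.X 1 ^ j)) +
        MvPolynomial.C (1 / 2) * MvPolynomial.X 0 * MvPolynomial.pderiv 0
          (MvPolynomial.C a * (MvPolynomial.X 0 ^ i * MvPolynomial.X 1 ^ j))) +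
        (MvPolynomial.C (p / 2) - MvPolynomial.C (q / 2) * MvPolynomial.X 1) *
          (MvPolynomial.C a * (MvPolynomial.X 0 ^ i * MvPolynomial.X 1 ^ j)) =
        MvPolynomial.C (a * (i / 2 + j + p / 2)) *
          (MvPolynomial.X (0 : Fin 2) ^ i * MvPolynomial.X 1 ^ j) -
        MvPolynomial.C (a * (i / 2 + j + q / 2)) *
          (MvPolynomial.X (0 : Fin 2) ^ i * MvPolynomial.X 1 ^ (j + 1)) := by
      have hi : MvPolynomial.C ((i : ℝ) / 2) = MvPolynomial.C (1 / 2) * (i : MvPolynomial (Fin 2)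
        ℝ) := by
        rw [div_eq_inv_mul, ← one_div, MvPolynomial.C_mul]; simp
      rcases i with _ | i <;> rcases j with _ | j <;>
        simp only [MvPolynomial.C_mul, MvPolynomial.C_add, hi] <;>
        simp [Derivation.leibniz, Derivation.leibniz_pow, MvPolynomial.pderiv_X] <;>
        ring
    rw [e, map_sub, prodFunctional_C_mul, prodFunctional_C_mul, prodFunctional_X_pow_mul,
        prodFunctional_X_pow_mul]
    linear_combination a * h1

/-- Integration by parts along the field `(1 - t) (∂_s + 2 s ∂_t)`. -/
lemma ProductMoments.functional_horizontal (hp : 0 < p) (hM : ProductMoments p q ρ η)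
    (h : MvPolynomial (Fin 2) ℝ) :
    prodFunctional ρ η ((1 - MvPolynomial.X 1) * (MvPolynomial.pderiv 0 h +
        2 * MvPolynomial.X 0 * MvPolynomial.pderiv 1 h) -
      MvPolynomial.C (q - p) * MvPolynomial.X 0 * h) = 0 := by
  induction h using MvPolynomial.induction_on' with
  | add f g hf hg =>
    refine Eq.trans ?_ (((map_add (prodFunctional ρ η) _ _).trans
      (congrArg₂ (· + ·) hf hg)).trans (add_zero 0))
    congr 1
    simp only [map_add]
    ring
  | monomial u a =>
    rw [MvPolynomial.monomial_eq, Finsupp.prod_fintype _ _ (by simp), Fin.prod_univ_two]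
    generalize u 0 = i
    generalize u 1 = j
    -- The truncated exponents i - 1 and j - 1 are harmless: their terms carry the factors i and j.
    have e : (1 - MvPolynomial.X 1) * (MvPolynomial.pderiv 0
          (MvPolynomial.C a * (MvPolynomial.X 0 ^ i * MvPolynomial.X 1 ^ j)) +
        2 * MvPolynomial.X 0 * MvPolynomial.pderiv 1
          (MvPolynomial.C a * (MvPolynomial.X 0 ^ i * MvPolynomial.X 1 ^ j))) -
        MvPolynomial.C (q - p) * MvPolynomial.X 0 *
          (MvPolynomial.C a * (MvPolynomial.X 0 ^ i * MvPolynomial.X 1 ^ j)) =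
        MvPolynomial.C (a * i) *
          (MvPolynomial.X (0 : Fin 2) ^ (i - 1) * MvPolynomial.X 1 ^ j) -
        MvPolynomial.C (a * i) *
          (MvPolynomial.X (0 : Fin 2) ^ (i - 1) * MvPolynomial.X 1 ^ (j + 1)) +
        MvPolynomial.C (a * (2 * j)) *
          (MvPolynomial.X (0 : Fin 2) ^ (i + 1) * MvPolynomial.X 1 ^ (j - 1)) -
        MvPolynomial.C (a * (2 * j + (q - p))) *
          (MvPolynomial.X (0 : Fin 2) ^ (i + 1) * MvPolynomial.X 1 ^ j) := by
      have h2 : (MvPolynomial.C (2 : ℝ) : MvPolynomial (Fin 2) ℝ) = 2 :=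
        map_ofNat MvPolynomial.C 2
      rcases j with _ | j <;>
        simp only [MvPolynomial.C_mul, MvPolynomial.C_add, h2] <;>
        simp [Derivation.leibniz, Derivation.leibniz_pow, MvPolynomial.pderiv_X] <;>
        ring
    rw [e, map_sub, map_add, map_sub]
    simp only [prodFunctional_C_mul, prodFunctional_X_pow_mul]
    rcases i with _ | l
    · have h1 (j : ℕ) := hM.prodMoment_odd hp 0 j
      simp only [mul_zero, zero_add] at h1 ⊢
      simp [h1]
    · have hl : (0 : ℝ) < l + p := by positivity
      have h1 := hM.prodMoment_radial hp l j
      have h2 := hM.prodMoment_angular l j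
      -- Multiplying by l + p lets the angular recursion rewrite moments with s^(l+2) as moments
      -- with s^l, to which the radial recursion applies.
      refine mul_left_cancel₀ hl.ne' ?_
      rcases j with _ | j
      · push_cast at h1 h2 ⊢
        simp only [show l + 1 + 1 = l + 2 from rfl]
        linear_combination 2 * a * (l + 1) * h1 + a * (q - p) * h2
      · have h3 := hM.prodMoment_angular l j
        push_cast at h1 h2 h3 ⊢
        simp only [show l + 1 + 1 = l + 2 from rfl]
        linear_combination 2 * a * (l + 1) * h1 + a * (q - p) * h2 + 2 * a * (j + 1) * (h2 - h3)

end Functional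

/-! ## The generalized translation intertwines the Jacobi operator -/

/-- The polynomial `Z = 2 (a² d² + b² e² t + 2 a b d e s) - 1`. -/
def transPoly (a b d e : ℝ) : MvPolynomial (Fin 2) ℝ :=
  MvPolynomial.C (2 * (a ^ 2 * d ^ 2) - 1) + MvPolynomial.C (2 * (b ^ 2 * e ^ 2)) *
    MvPolynomial.X 1 +
    MvPolynomial.C (4 * (a * b * d * e)) * MvPolynomial.X 0

/-- The value of `Z` at `ω`. -/
def transVal (a b d e : ℝ) (ω : JacobiInterval × JacobiInterval) : ℝ :=
  2 * (a ^ 2 * d ^ 2) - 1 + 2 * (b ^ 2 * e ^ 2) * radSq ω + 4 * (a * b * d * e) * absc ω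

/-- Half the derivative of `Z` along the rotation `a' = -b`, `b' = a`. -/
def transRot (a b d e : ℝ) (ω : JacobiInterval × JacobiInterval) : ℝ :=
  2 * a * b * (e ^ 2 * radSq ω - d ^ 2) + 2 * (a ^ 2 - b ^ 2) * d * e * absc ω

/-- Half the second derivative of `Z` along the rotation. -/
def transRotTwo (a b d e : ℝ) (ω : JacobiInterval × JacobiInterval) : ℝ :=
  2 * (a ^ 2 - b ^ 2) * (e ^ 2 * radSq ω - d ^ 2) - 8 * a * b * d * e * absc ω

lemma eval_transPoly (a b d e : ℝ) (ω : JacobiInterval × JacobiInterval) :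
    MvPolynomial.eval ![absc ω, radSq ω] (transPoly a b d e) = transVal a b d e ω := by
  simp [transPoly, transVal]

lemma eval_aeval_mvPolynomial {σ : Type*} (v : σ → ℝ) (Z : MvPolynomial σ ℝ) (f : ℝ[X]) :
    MvPolynomial.eval v (aeval Z f) = f.eval (MvPolynomial.eval v Z) := by
  induction f using Polynomial.induction_on' with
  | add f g hf hg => simp [hf, hg]
  | monomial n c => simp [aeval_monomial, MvPolynomial.algebraMap_eq]

lemma pderiv_aeval_polynomial {σ : Type*} (i : σ) (Z : MvPolynomial σ ℝ) (f : ℝ[X]) :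
    MvPolynomial.pderiv i (aeval Z f) = aeval Z (derivative f) * MvPolynomial.pderiv i Z := by
  induction f using Polynomial.induction_on' with
  | add f g hf hg => simp [hf, hg, add_mul]
  | monomial n c =>
    simp [aeval_monomial, derivative_monomial, Derivation.leibniz, Derivation.leibniz_pow,
      MvPolynomial.algebraMap_eq]
    ring

/-- The pointwise identity behind the intertwining relation. -/
lemma intertwining_algebra {a b d e s t p q F₁ F₂ Z : ℝ} (h1 : a ^ 2 + b ^ 2 = 1)
    (h2 : d ^ 2 + e ^ 2 = 1)
    (hZ : Z = 2 * (a ^ 2 * d ^ 2) - 1 + 2 * (b ^ 2 * e ^ 2) * t + 4 * (a * b * d * e) * s) :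
    a * b * (4 * (2 * a * b * (e ^ 2 * t - d ^ 2) + 2 * (a ^ 2 - b ^ 2) * d * e * s) ^ 2 * F₂ +
        2 * (2 * (a ^ 2 - b ^ 2) * (e ^ 2 * t - d ^ 2) - 8 * a * b * d * e * s) * F₁) -
      2 * (a ^ 2 - b ^ 2 + (p - q) / 2 - (p + q) / 2 * (a ^ 2 - b ^ 2)) *
        (2 * a * b * (e ^ 2 * t - d ^ 2) + 2 * (a ^ 2 - b ^ 2) * d * e * s) * F₁ -
      4 * a * b * ((1 - Z ^ 2) * F₂ + ((p - q) / 2 - (p + q) / 2 * Z) * F₁) =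
    -(8 * a * b * e ^ 2) * ((1 - t) * (t * (2 * (b ^ 2 * e ^ 2) * F₂) +
        1 / 2 * s * (4 * (a * b * d * e) * F₂)) + (p / 2 - q / 2 * t) * F₁) -
      4 * a ^ 2 * d * e * ((1 - t) * (4 * (a * b * d * e) * F₂ +
        2 * s * (2 * (b ^ 2 * e ^ 2) * F₂)) - (q - p) * s * F₁) -
      4 * d * e * ((t - s ^ 2) * (4 * (a * b * d * e) * F₂) - (p - 1) * s * F₁) := by
  grind

@[fun_prop] lemma continuous_transVal (a b d e : ℝ) : Continuous (transVal a b d e) := by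
  unfold transVal; fun_prop

@[fun_prop] lemma continuous_transRot (a b d e : ℝ) : Continuous (transRot a b d e) := by
  unfold transRot; fun_prop

@[fun_prop] lemma continuous_transRotTwo (a b d e : ℝ) : Continuous (transRotTwo a b d e) := by
  unfold transRotTwo; fun_prop

lemma hasDerivAt_transVal (d e θ : ℝ) (ω : JacobiInterval × JacobiInterval) :
    HasDerivAt (fun θ => transVal (Real.cos θ) (Real.sin θ) d e ω)
      (2 * transRot (Real.cos θ) (Real.sin θ) d e ω) θ := by
  unfold transVal transRot
  have hc := Real.hasDerivAt_cos θ
  have hs := Real.hasDerivAt_sin θ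
  refine ((((((hc.pow 2).mul_const (d ^ 2)).const_mul 2).sub_const 1).add
    ((((hs.pow 2).mul_const (e ^ 2)).const_mul 2).mul_const (radSq ω))).add
    (((((hc.mul hs).mul_const d).mul_const e).const_mul 4).mul_const (absc ω))).congr_deriv ?_
  push_cast
  ring

lemma hasDerivAt_transRot (d e θ : ℝ) (ω : JacobiInterval × JacobiInterval) :
    HasDerivAt (fun θ => transRot (Real.cos θ) (Real.sin θ) d e ω)
      (transRotTwo (Real.cos θ) (Real.sin θ) d e ω) θ := by
  unfold transRot transRotTwo
  have hc := Real.hasDerivAt_cos θ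
  have hs := Real.hasDerivAt_sin θ
  refine ((((hc.const_mul 2).mul hs).mul_const _).add
    ((((((hc.pow 2).sub (hs.pow 2)).const_mul 2).mul_const d).mul_const e).mul_const
      (absc ω))).congr_deriv ?_
  push_cast
  ring

lemma hasDerivAt_integral_of_compactSpace {Ω : Type*} [TopologicalSpace Ω] [CompactSpace Ω]
    [MeasurableSpace Ω] [OpensMeasurableSpace Ω] {μ : Measure Ω} [IsFiniteMeasure μ]
    {F F' : ℝ → Ω → ℝ} (hF : Continuous (Function.uncurry F))
    (hF' : Continuous (Function.uncurry F')) (h : ∀ θ ω, HasDerivAt (fun θ => F θ ω) (F' θ ω) θ)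
    (θ : ℝ) : HasDerivAt (fun θ => ∫ ω, F θ ω ∂μ) (∫ ω, F' θ ω ∂μ) θ := by
  -- Compactness of the closed unit ball times Ω bounds the θ-derivative uniformly, which supplies
  -- the dominating constant.
  obtain ⟨C, hC⟩ := ((isCompact_closedBall θ 1).prod (isCompact_univ (X :=
    Ω))).exists_bound_of_continuousOn
    hF'.continuousOn
  have cF (θ : ℝ) : Continuous (F θ) := hF.comp (by fun_prop : Continuous fun ω : Ω => (θ, ω))
  have cF' (θ : ℝ) : Continuous (F' θ) := hF'.comp (by fun_prop : Continuous fun ω : Ω => (θ, ω))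
  refine (hasDerivAt_integral_of_dominated_loc_of_deriv_le (Metric.ball_mem_nhds θ one_pos)
    (Filter.Eventually.of_forall fun θ => (cF θ).measurable.aestronglyMeasurable)
    (integrable_of_continuous_compact (cF θ)) (cF' θ).measurable.aestronglyMeasurable
    (bound := fun _ => C) ?_ (integrable_const C) ?_).2
  · exact Filter.Eventually.of_forall fun ω x hx =>
      hC (x, ω) ⟨Metric.ball_subset_closedBall hx, trivial⟩
  · exact Filter.Eventually.of_forall fun ω x _ => h x ω

section Intertwining

variable {ρ η : Measure JacobiInterval} [IsProbabilityMeasure ρ] [IsProbabilityMeasure η]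
  {p q : ℝ}

/-- The left side is 4ab L written in the angle θ, where x = cos 2θ, a = cos θ, b = sin θ and dx/dθ
= -4ab, with the θ-derivatives taken under the integral. The factor ab clears the poles of the
first-order coefficient. -/
lemma ProductMoments.intertwining (hp : 0 < p) (hM : ProductMoments p q ρ η) {a b d e : ℝ}
    (h1 : a ^ 2 + b ^ 2 = 1) (h2 : d ^ 2 + e ^ 2 = 1) (f : ℝ[X]) :
    a * b * ∫ ω, (4 * transRot a b d e ω ^ 2 * (derivative (derivative f)).eval (transVal a b d e ω)
        + 2 * transRotTwo a b d e ω * (derivative f).eval (transVal a b d e ω)) ∂(ρ.prod η) -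
      (a ^ 2 - b ^ 2 + (p - q) / 2 - (p + q) / 2 * (a ^ 2 - b ^ 2)) *
        ∫ ω, 2 * transRot a b d e ω * (derivative f).eval (transVal a b d e ω) ∂(ρ.prod η) =
    4 * a * b * ∫ ω, (jacobiOp p q f).eval (transVal a b d e ω) ∂(ρ.prod η) := by
  have i1 : Integrable (fun ω => a * b * (4 * transRot a b d e ω ^ 2 *
      (derivative (derivative f)).eval (transVal a b d e ω)
        + 2 * transRotTwo a b d e ω * (derivative f).eval (transVal a b d e ω))) (ρ.prod η) :=
    integrable_of_continuous_compact (by fun_prop)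
  have i2 : Integrable (fun ω => (a ^ 2 - b ^ 2 + (p - q) / 2 - (p + q) / 2 * (a ^ 2 - b ^ 2)) *
      (2 * transRot a b d e ω * (derivative f).eval (transVal a b d e ω))) (ρ.prod η) :=
    integrable_of_continuous_compact (by fun_prop)
  have i3 : Integrable (fun ω => 4 * a * b * (jacobiOp p q f).eval (transVal a b d e ω))
      (ρ.prod η) :=
    integrable_of_continuous_compact (by fun_prop)
  rw [← sub_eq_zero, ← integral_const_mul, ← integral_const_mul, ← integral_const_mul,
    ← integral_sub i1 i2, ← integral_sub ?_ i3]
  swap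
  · exact i1.sub i2
  -- The three mean-zero identities are applied to f'(Z). Its partial derivatives produce f''(Z),
  -- and the coefficients in `key` are those of `intertwining_algebra`.
  set h := aeval (transPoly a b d e) (derivative f) with hh
  have e1 := hM.functional_radial hp h
  have e2 := hM.functional_horizontal hp h
  have e3 := hM.functional_angular hp h
  have key : prodFunctional ρ η
      (MvPolynomial.C (-(8 * a * b * e ^ 2)) * ((1 - MvPolynomial.X 1) *
        (MvPolynomial.X 1 * MvPolynomial.pderiv 1 h +
          MvPolynomial.C (1 / 2) * MvPolynomial.X 0 * MvPolynomial.pderiv 0 h) +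
        (MvPolynomial.C (p / 2) - MvPolynomial.C (q / 2) * MvPolynomial.X 1) * h) -
      MvPolynomial.C (4 * a ^ 2 * d * e) * ((1 - MvPolynomial.X 1) * (MvPolynomial.pderiv 0 h +
        2 * MvPolynomial.X 0 * MvPolynomial.pderiv 1 h) -
        MvPolynomial.C (q - p) * MvPolynomial.X 0 * h) -
      MvPolynomial.C (4 * d * e) * ((MvPolynomial.X 1 - MvPolynomial.X 0 ^ 2) *
        MvPolynomial.pderiv 0 h - MvPolynomial.C (p - 1) * MvPolynomial.X 0 * h)) = 0 := by
    rw [map_sub, map_sub, prodFunctional_C_mul, prodFunctional_C_mul, prodFunctional_C_mul,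
      e1, e2, e3]
    ring
  rw [prodFunctional_apply] at key
  rw [← key]
  congr 1
  ext ω
  have hd0 : MvPolynomial.eval ![absc ω, radSq ω] (MvPolynomial.pderiv 0 h) =
      4 * (a * b * d * e) * (derivative (derivative f)).eval (transVal a b d e ω) := by
    rw [hh, pderiv_aeval_polynomial, map_mul, eval_aeval_mvPolynomial, eval_transPoly]
    simp [transPoly, MvPolynomial.pderiv_X]
    ring
  have hd1 : MvPolynomial.eval ![absc ω, radSq ω] (MvPolynomial.pderiv 1 h) =
      2 * (b ^ 2 * e ^ 2) * (derivative (derivative f)).eval (transVal a b d e ω) := by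
    rw [hh, pderiv_aeval_polynomial, map_mul, eval_aeval_mvPolynomial, eval_transPoly]
    simp [transPoly, MvPolynomial.pderiv_X]
    ring
  have hd : MvPolynomial.eval ![absc ω, radSq ω] h = (derivative f).eval (transVal a b d e ω) := by
    rw [hh, eval_aeval_mvPolynomial, eval_transPoly]
  have alg := intertwining_algebra (s := absc ω) (t := radSq ω) (p := p) (q := q)
    (F₁ := (derivative f).eval (transVal a b d e ω))
    (F₂ := (derivative (derivative f)).eval (transVal a b d e ω))
    (Z := transVal a b d e ω) h1 h2 rfl
  simp only [map_sub, map_add, map_mul, map_pow, map_one, MvPolynomial.eval_C,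
    MvPolynomial.eval_X, hd0, hd1, hd, Matrix.cons_val_zero, Matrix.cons_val_one, map_ofNat,
    jacobiOp, eval_add, eval_mul, eval_sub, eval_pow, eval_X, eval_C, eval_one]
  simp only [transRot, transRotTwo]
  linear_combination alg

/-- If the translate of `f` is a polynomial `H` in `x = cos 2θ`, then the translate of `L f` is
`L H`. -/
lemma ProductMoments.eval_jacobiOp_of_translate (hp : 0 < p) (hM : ProductMoments p q ρ η)
    {d e : ℝ} (h2 : d ^ 2 + e ^ 2 = 1) {f H : ℝ[X]}
    (hH : ∀ θ : ℝ, ∫ ω, f.eval (transVal (Real.cos θ) (Real.sin θ) d e ω) ∂(ρ.prod η) =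
      H.eval (2 * Real.cos θ ^ 2 - 1)) {θ : ℝ} (hθ : Real.cos θ * Real.sin θ ≠ 0) :
    ∫ ω, (jacobiOp p q f).eval (transVal (Real.cos θ) (Real.sin θ) d e ω) ∂(ρ.prod η) =
      (jacobiOp p q H).eval (2 * Real.cos θ ^ 2 - 1) := by
  have hx (θ : ℝ) : HasDerivAt (fun θ : ℝ => 2 * Real.cos θ ^ 2 - 1)
      (-(4 * Real.cos θ * Real.sin θ)) θ := by
    refine ((((Real.hasDerivAt_cos θ).pow 2).const_mul 2).sub_const 1).congr_deriv ?_
    push_cast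
    ring
  -- The identity `hH` is differentiated in θ, under the integral on one side and by the chain rule
  -- on the other; `hG2` does this once more.
  have hG1 (θ : ℝ) : ∫ ω, 2 * transRot (Real.cos θ) (Real.sin θ) d e ω *
      (derivative f).eval (transVal (Real.cos θ) (Real.sin θ) d e ω) ∂(ρ.prod η) =
      (derivative H).eval (2 * Real.cos θ ^ 2 - 1) * (-(4 * Real.cos θ * Real.sin θ)) := by
    have c1 := hasDerivAt_integral_of_compactSpace (μ := ρ.prod η)
      (F := fun θ ω => f.eval (transVal (Real.cos θ) (Real.sin θ) d e ω))
      (F' := fun θ ω => 2 * transRot (Real.cos θ) (Real.sin θ) d e ω *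
        (derivative f).eval (transVal (Real.cos θ) (Real.sin θ) d e ω))
      (by simp only [Function.uncurry_def]; unfold transVal; fun_prop)
      (by simp only [Function.uncurry_def]; unfold transVal transRot; fun_prop)
      (fun θ ω => ((f.hasDerivAt _).comp θ (hasDerivAt_transVal d e θ ω)).congr_deriv (mul_comm _
        _))
      θ
    simp only [hH] at c1
    exact c1.unique ((H.hasDerivAt _).comp θ (hx θ))
  have hG2 : ∫ ω, (4 * transRot (Real.cos θ) (Real.sin θ) d e ω ^ 2 *
      (derivative (derivative f)).eval (transVal (Real.cos θ) (Real.sin θ) d e ω) +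
      2 * transRotTwo (Real.cos θ) (Real.sin θ) d e ω *
        (derivative f).eval (transVal (Real.cos θ) (Real.sin θ) d e ω)) ∂(ρ.prod η) =
      (derivative (derivative H)).eval (2 * Real.cos θ ^ 2 - 1) *
        (16 * Real.cos θ ^ 2 * Real.sin θ ^ 2) - 4 * (Real.cos θ ^ 2 - Real.sin θ ^ 2) *
        (derivative H).eval (2 * Real.cos θ ^ 2 - 1) := by
    have c1 := hasDerivAt_integral_of_compactSpace (μ := ρ.prod η)
      (F := fun θ ω => 2 * transRot (Real.cos θ) (Real.sin θ) d e ω *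
        (derivative f).eval (transVal (Real.cos θ) (Real.sin θ) d e ω))
      (F' := fun θ ω => 4 * transRot (Real.cos θ) (Real.sin θ) d e ω ^ 2 *
      (derivative (derivative f)).eval (transVal (Real.cos θ) (Real.sin θ) d e ω) +
      2 * transRotTwo (Real.cos θ) (Real.sin θ) d e ω *
        (derivative f).eval (transVal (Real.cos θ) (Real.sin θ) d e ω))
      (by simp only [Function.uncurry_def]; unfold transVal transRot; fun_prop)
      (by simp only [Function.uncurry_def]; unfold transVal transRot transRotTwo; fun_prop)
      (fun θ ω => (((hasDerivAt_transRot d e θ ω).const_mul 2).mul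
        (((derivative f).hasDerivAt _).comp θ (hasDerivAt_transVal d e θ ω))).congr_deriv
          (by simp only [Function.comp]; ring))
      θ
    simp only [hG1] at c1
    refine c1.unique (((((derivative H).hasDerivAt _).comp θ (hx θ)).mul
      ((((Real.hasDerivAt_cos θ).const_mul 4).mul (Real.hasDerivAt_sin θ)).neg)).congr_deriv ?_)
    simp only [Function.comp, Pi.neg_apply, Pi.mul_apply]
    ring
  have h1 := Real.cos_sq_add_sin_sq θ
  have hI := hM.intertwining hp h1 h2 f
  rw [hG1, hG2] at hI
  have h4 : 4 * Real.cos θ * Real.sin θ ≠ 0 := by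
    rw [mul_assoc]; exact mul_ne_zero (by norm_num) hθ
  refine mul_left_cancel₀ h4 ?_
  rw [← hI]
  simp only [jacobiOp, eval_add, eval_mul, eval_sub, eval_pow, eval_X, eval_C, eval_one]
  have hs : Real.sin θ ^ 2 = 1 - Real.cos θ ^ 2 := by linarith
  rw [hs]
  ring

end Intertwining

section ProductFormula

variable {ρ η : Measure JacobiInterval} [IsProbabilityMeasure ρ] [IsProbabilityMeasure η]
  {p q : ℝ}

/-! ## The product formula -/

lemma ProductMoments.integral_absc_odd (hp : 0 < p) (hM : ProductMoments p q ρ η) (l : ℕ)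
    (Q : ℝ[X]) : ∫ ω, absc ω ^ (2 * l + 1) * Q.eval (radSq ω) ∂(ρ.prod η) = 0 := by
  have h := integral_prod_mul (μ := ρ) (ν := η)
    (fun x : JacobiInterval => √((1 + (x : ℝ)) / 2) ^ (2 * l + 1) * Q.eval ((1 + (x : ℝ)) / 2))
    (fun x : JacobiInterval => (x : ℝ) ^ (2 * l + 1))
  rw [hM.angular_odd hp, mul_zero] at h
  rw [← h]
  congr 1
  ext ω
  simp only [absc, radSq]
  ring

/-- After b² = 1 - a², Z is 4abde s plus a term affine in a². Odd powers of s integrate to zero, so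
ab enters only through (ab)² = a²(1 - a²). -/
lemma ProductMoments.exists_translate_pow (hp : 0 < p) (hM : ProductMoments p q ρ η) (d e : ℝ)
    (n : ℕ) : ∃ H : ℝ[X], H.natDegree ≤ n ∧ ∀ a b : ℝ, a ^ 2 + b ^ 2 = 1 →
      ∫ ω, transVal a b d e ω ^ n ∂(ρ.prod η) = H.eval (a ^ 2) := by
  set V₁ : ℝ[X] := C (2 * d ^ 2) - C (2 * e ^ 2) * X with hV₁
  set V₀ : ℝ[X] := C (2 * e ^ 2) * X - 1 with hV₀
  set K : ℕ → ℕ → ℝ := fun m j =>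
    ∫ ω, absc ω ^ m * (V₁ ^ j * V₀ ^ (n - m - j)).eval (radSq ω) ∂(ρ.prod η) with hK
  -- The sum comes from two binomial expansions: m is the power of s, j the power of a² from the
  -- affine term. The m-th term has degree at most m + (n - m) = n in a².
  refine ⟨∑ m ∈ Finset.range (n + 1), if Even m then
    C (n.choose m : ℝ) * ((C (16 * d ^ 2 * e ^ 2) * (X * (1 - X))) ^ (m / 2) *
      ∑ j ∈ Finset.range (n - m + 1), C ((n - m).choose j * K m j) * X ^ j) else 0, ?_, ?_⟩
  · refine natDegree_sum_le_of_forall_le _ _ fun m hm => ?_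
    have hm' : m ≤ n := by simpa [Nat.lt_succ_iff] using hm
    split_ifs with he
    · refine (natDegree_C_mul_le _ _).trans (natDegree_mul_le.trans ?_)
      have h1 : ((C (16 * d ^ 2 * e ^ 2) * (X * (1 - X)) : ℝ[X]) ^ (m / 2)).natDegree ≤
          m / 2 * 2 := by
        refine natDegree_pow_le.trans (Nat.mul_le_mul_left _ ?_)
        compute_degree
      have h2 : (∑ j ∈ Finset.range (n - m + 1), C ((n - m).choose j * K m j) * X ^ j).natDegree ≤
          n - m := by
        refine natDegree_sum_le_of_forall_le _ _ fun j hj => ?_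
        have hj' : j ≤ n - m := by simpa [Nat.lt_succ_iff] using hj
        exact (natDegree_C_mul_X_pow_le _ _).trans hj'
      have h3 : m / 2 * 2 ≤ m := Nat.div_mul_le_self m 2
      omega
    · simp
  · intro a b hab
    have expand (ω : JacobiInterval × JacobiInterval) : transVal a b d e ω ^ n =
        ∑ m ∈ Finset.range (n + 1), ∑ j ∈ Finset.range (n - m + 1),
          ((4 * (a * b * d * e)) ^ m * (n.choose m) * ((a ^ 2) ^ j * ((n - m).choose j))) *
            (absc ω ^ m * (V₁ ^ j * V₀ ^ (n - m - j)).eval (radSq ω)) := by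
      have e1 : transVal a b d e ω = 4 * (a * b * d * e) * absc ω +
          (a ^ 2 * V₁.eval (radSq ω) + V₀.eval (radSq ω)) := by
        have hb : b ^ 2 = 1 - a ^ 2 := by linarith
        simp only [transVal, hV₁, hV₀, eval_sub, eval_mul, eval_C, eval_X, eval_one, hb]
        ring
      rw [e1, add_pow]
      refine Finset.sum_congr rfl fun m _ => ?_
      rw [add_pow, Finset.mul_sum, Finset.sum_mul]
      refine Finset.sum_congr rfl fun j _ => ?_
      rw [eval_mul, eval_pow, eval_pow]
      ring
    simp only [expand]
    rw [integral_finsetSum _ fun m _ => integrable_of_continuous_compact (by fun_prop),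
      eval_finsetSum]
    refine Finset.sum_congr rfl fun m _ => ?_
    rw [integral_finsetSum _ fun j _ => integrable_of_continuous_compact (by fun_prop)]
    simp only [integral_const_mul]
    split_ifs with he
    · obtain ⟨l, rfl⟩ := he
      rw [eval_mul, eval_mul, eval_finsetSum, Finset.mul_sum, Finset.mul_sum]
      refine Finset.sum_congr rfl fun j _ => ?_
      have hb : b ^ 2 = 1 - a ^ 2 := by linarith
      have e2 : (4 * (a * b * d * e)) ^ (l + l) =
          (16 * d ^ 2 * e ^ 2 * (a ^ 2 * (1 - a ^ 2))) ^ l := by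
        rw [← two_mul, pow_mul, ← hb]; ring_nf
      have e3 : (l + l) / 2 = l := by omega
      rw [e2, e3]
      simp only [eval_mul, eval_pow, eval_C, eval_X, eval_sub, eval_one, hK]
      ring
    · rw [Nat.not_even_iff_odd] at he
      obtain ⟨l, rfl⟩ := he
      rw [eval_zero]
      refine Finset.sum_eq_zero fun j _ => ?_
      rw [hM.integral_absc_odd hp, mul_zero]

lemma ProductMoments.exists_translate (hp : 0 < p) (hM : ProductMoments p q ρ η) (d e : ℝ)
    {n : ℕ} {f : ℝ[X]} (hf : f.natDegree ≤ n) : ∃ H : ℝ[X], H.natDegree ≤ n ∧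
      ∀ a b : ℝ, a ^ 2 + b ^ 2 = 1 →
        ∫ ω, f.eval (transVal a b d e ω) ∂(ρ.prod η) = H.eval (2 * a ^ 2 - 1) := by
  choose H hH1 hH2 using hM.exists_translate_pow hp d e
  -- Composition with (X + 1)/2 passes from the variable a² to x = 2a² - 1.
  refine ⟨(∑ i ∈ Finset.range (n + 1), C (f.coeff i) * H i).comp (C (1 / 2) * (X + 1)), ?_, ?_⟩
  · refine natDegree_comp_le.trans ?_
    have h1 : (C (1 / 2) * (X + 1) : ℝ[X]).natDegree ≤ 1 := by compute_degree
    have h2 : (∑ i ∈ Finset.range (n + 1), C (f.coeff i) * H i).natDegree ≤ n := by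
      refine natDegree_sum_le_of_forall_le _ _ fun i hi => ?_
      have hi' : i ≤ n := by simpa [Nat.lt_succ_iff] using hi
      exact (natDegree_C_mul_le _ _).trans ((hH1 i).trans hi')
    exact (Nat.mul_le_mul h2 h1).trans (by simp)
  · intro a b hab
    have e1 : (C (1 / 2) * (X + 1) : ℝ[X]).eval (2 * a ^ 2 - 1) = a ^ 2 := by simp
    rw [eval_comp, e1, eval_finsetSum]
    simp only [eval_eq_sum_range' (Nat.lt_succ_of_le hf), eval_mul, eval_C]
    rw [integral_finsetSum _ fun m _ => integrable_of_continuous_compact (by fun_prop)]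
    simp only [integral_const_mul]
    exact Finset.sum_congr rfl fun i _ => by rw [hH2 i a b hab]

lemma ProductMoments.exists_translate_jacobiPoly (hp : 1 ≤ p) (hq : 1 ≤ q)
    (hM : ProductMoments p q ρ η) {d e : ℝ} (h2 : d ^ 2 + e ^ 2 = 1) (k : ℕ) :
    ∃ c : ℝ, ∀ a b : ℝ, a ^ 2 + b ^ 2 = 1 →
      ∫ ω, (jacobiPoly p q k).eval (transVal a b d e ω) ∂(ρ.prod η) =
        c * (jacobiPoly p q k).eval (2 * a ^ 2 - 1) := by
  have hp0 : 0 < p := by linarith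
  have hq0 : 0 < q := by linarith
  obtain ⟨H, hH1, hH2⟩ := hM.exists_translate hp0 d e (natDegree_jacobiPoly hp0 hq0 k).le
  have hL : jacobiOp p q H = - C (jacobiEigenvalue p q k) * H := by
    -- The eigenvalue equation is available only where ab ≠ 0, that is for interior x; for
    -- polynomials this is enough.
    refine eq_of_infinite_eval_eq _ _ ((Set.Ioo_infinite (by norm_num : (-1 : ℝ) < 1)).mono ?_)
    intro x hx
    have h0 : 0 < (1 + x) / 2 := by linarith [hx.1]
    have h1 : (1 + x) / 2 < 1 := by linarith [hx.2]
    have hs0 : 0 < √((1 + x) / 2) := Real.sqrt_pos.2 h0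
    have hs1 : √((1 + x) / 2) ≤ 1 := Real.sqrt_le_one.2 h1.le
    have hcos : Real.cos (Real.arccos √((1 + x) / 2)) = √((1 + x) / 2) :=
      Real.cos_arccos (by linarith) hs1
    have hne : Real.cos (Real.arccos √((1 + x) / 2)) * Real.sin (Real.arccos √((1 + x) / 2)) ≠ 0
      := by
      rw [hcos, Real.sin_arccos, Real.sq_sqrt h0.le]
      exact mul_ne_zero hs0.ne' (Real.sqrt_pos.2 (by linarith)).ne'
    have e1 := hM.eval_jacobiOp_of_translate hp0 h2
      (fun θ => hH2 _ _ (Real.cos_sq_add_sin_sq θ)) hne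
    have e2 := hH2 _ _ (Real.cos_sq_add_sin_sq (Real.arccos √((1 + x) / 2)))
    rw [jacobiOp_jacobiPoly hp0 hq0] at e1
    simp only [neg_mul, eval_neg, eval_mul, eval_C, integral_neg, integral_const_mul, e2] at e1
    rw [hcos, Real.sq_sqrt h0.le] at e1
    ring_nf at e1
    simp only [Set.mem_ofPred_eq, neg_mul, eval_neg, eval_mul, eval_C]
    linarith
  obtain ⟨c, hc⟩ := eq_C_mul_jacobiPoly_of_jacobiOp hp hq hH1 hL
  refine ⟨c, fun a b hab => ?_⟩
  rw [hH2 a b hab, hc, eval_mul, eval_C]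

lemma transVal_one_zero (d e : ℝ) (ω : JacobiInterval × JacobiInterval) :
    transVal 1 0 d e ω = 2 * d ^ 2 - 1 := by
  simp [transVal]

/-- At x = 1 the translate of P_k is both P_k(y) and c P_k(1); if P_k(1) = 0, then P_k would vanish
on all of [-1, 1]. -/
lemma ProductMoments.eval_jacobiPoly_one_ne_zero (hp : 1 ≤ p) (hq : 1 ≤ q)
    (hM : ProductMoments p q ρ η) (k : ℕ) : (jacobiPoly p q k).eval 1 ≠ 0 := by
  intro h
  refine jacobiPoly_ne_zero (by linarith : 0 < p) (by linarith : 0 < q) k ?_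
  refine eq_zero_of_infinite_isRoot _ ((Set.Icc_infinite (by norm_num : (-1 : ℝ) < 1)).mono ?_)
  intro y hy
  have h0 : 0 ≤ (1 + y) / 2 := by linarith [hy.1]
  have h1 : 0 ≤ (1 - y) / 2 := by linarith [hy.2]
  obtain ⟨c, hc⟩ := hM.exists_translate_jacobiPoly hp hq (d := √((1 + y) / 2))
    (e := √((1 - y) / 2)) (by rw [Real.sq_sqrt h0, Real.sq_sqrt h1]; ring) k
  have e1 := hc 1 0 (by norm_num)
  simp only [transVal_one_zero, integral_const, probReal_univ, one_smul, Real.sq_sqrt h0] at e1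
  norm_num [h] at e1
  rw [Set.mem_ofPred_eq, IsRoot]
  rw [← e1]
  ring_nf

lemma ProductMoments.product_formula_transVal (hp : 1 ≤ p) (hq : 1 ≤ q)
    (hM : ProductMoments p q ρ η) {a b d e : ℝ} (h1 : a ^ 2 + b ^ 2 = 1)
    (h2 : d ^ 2 + e ^ 2 = 1) (k : ℕ) :
    (jacobiPoly p q k).eval (2 * a ^ 2 - 1) * (jacobiPoly p q k).eval (2 * d ^ 2 - 1) /
      (jacobiPoly p q k).eval 1 =
        ∫ ω, (jacobiPoly p q k).eval (transVal a b d e ω) ∂(ρ.prod η) := by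
  obtain ⟨c, hc⟩ := hM.exists_translate_jacobiPoly hp hq h2 k
  have e1 := hc 1 0 (by norm_num)
  simp only [transVal_one_zero, integral_const, probReal_univ, one_smul] at e1
  norm_num at e1
  rw [hc a b h1, e1, div_eq_iff (hM.eval_jacobiPoly_one_ne_zero hp hq k)]
  ring

end ProductFormula

/-! ## Markov operators from invariant kernels -/

section MarkovOperator

variable {E : Type*} [MeasurableSpace E] {μ : Measure E} {k : Kernel E E}

/-- A μ-null set is null for k x for almost every x, by invariance; so averaging by k is well
defined on classes in L²(μ). -/
lemma ae_integral_eq_of_invariant (hk : k ∘ₘ μ = μ) {g h : E → ℝ} (hgh : g =ᵐ[μ] h) :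
    (fun x => ∫ y, g y ∂k x) =ᵐ[μ] fun x => ∫ y, h y ∂k x := by
  have h1 : ∀ᵐ y ∂(k ∘ₘ μ), g y = h y := by rw [hk]; exact hgh
  filter_upwards [Measure.ae_ae_of_ae_comp h1] with x hx
  exact integral_congr_ae hx

variable [IsProbabilityMeasure μ]

lemma ae_integrable_of_invariant (hk : k ∘ₘ μ = μ) {g : E → ℝ} (hg : MemLp g 2 μ) :
    ∀ᵐ x ∂μ, Integrable g (k x) := by
  have h1 : Integrable g (k ∘ₘ μ) := by rw [hk]; exact hg.integrable one_le_two
  exact ((Measure.integrable_comp_iff h1.1).1 h1).1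

lemma integrable_integral_of_invariant (hk : k ∘ₘ μ = μ) {g : E → ℝ} (hg : MemLp g 2 μ) :
    Integrable (fun x => ∫ y, g y ∂k x) μ := by
  have h1 : Integrable g (k ∘ₘ μ) := by rw [hk]; exact hg.integrable one_le_two
  rw [Measure.comp_eq_comp_const_apply] at h1
  simpa using h1.integral_comp

variable [IsMarkovKernel k]

/-- Jensen for each probability measure k x bounds |∫ g dk x|² by ∫ |g|² dk x, and invariance
integrates this bound to ∫ |g|² dμ. -/
lemma eLpNorm_integral_le_of_invariant (hk : k ∘ₘ μ = μ) {g : E → ℝ} (hg : MemLp g 2 μ) :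
    eLpNorm (fun x => ∫ y, g y ∂k x) 2 μ ≤ eLpNorm g 2 μ := by
  have h2 : (2 : NNReal) ≠ 0 := two_ne_zero
  have hpt : ∀ᵐ x ∂μ, ‖∫ y, g y ∂k x‖ₑ ^ ((2 : NNReal) : ℝ) ≤
      ∫⁻ y, ‖g y‖ₑ ^ ((2 : NNReal) : ℝ) ∂k x := by
    filter_upwards [ae_integrable_of_invariant hk hg] with x hx
    rw [← eLpNorm_nnreal_pow_eq_lintegral h2]
    refine ENNReal.rpow_le_rpow ?_ (by positivity)
    refine (enorm_integral_le_lintegral_enorm _).trans ?_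
    rw [← eLpNorm_one_eq_lintegral_enorm]
    exact eLpNorm_le_eLpNorm_of_exponent_le (by norm_num) hx.1
  have key : eLpNorm (fun x => ∫ y, g y ∂k x) (2 : NNReal) μ ^ ((2 : NNReal) : ℝ) ≤
      eLpNorm g (2 : NNReal) μ ^ ((2 : NNReal) : ℝ) := by
    rw [eLpNorm_nnreal_pow_eq_lintegral h2, eLpNorm_nnreal_pow_eq_lintegral h2]
    refine (lintegral_mono_ae hpt).trans ?_
    rw [← Measure.lintegral_bind k.aemeasurable, hk]
    rw [hk]
    exact hg.1.enorm.pow_const _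
  exact (ENNReal.rpow_le_rpow_iff (by positivity)).1 key

lemma memLp_integral_of_invariant (hk : k ∘ₘ μ = μ) {g : E → ℝ} (hg : MemLp g 2 μ) :
    MemLp (fun x => ∫ y, g y ∂k x) 2 μ :=
  ⟨(integrable_integral_of_invariant hk hg).1,
    (eLpNorm_integral_le_of_invariant hk hg).trans_lt hg.2⟩

/-- The operator on `L²(μ)` given by a Markov kernel that leaves `μ` invariant. -/
def kernelOperator (hk : k ∘ₘ μ = μ) : Lp ℝ 2 μ →L[ℝ] Lp ℝ 2 μ :=
  LinearMap.mkContinuous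
    { toFun := fun G => (memLp_integral_of_invariant hk (Lp.memLp G)).toLp _
      map_add' := fun F G => by
        rw [← MemLp.toLp_add]
        refine MemLp.toLp_congr _ _ ?_
        refine (ae_integral_eq_of_invariant hk (Lp.coeFn_add F G)).trans ?_
        filter_upwards [ae_integrable_of_invariant hk (Lp.memLp F),
          ae_integrable_of_invariant hk (Lp.memLp G)] with x hF hG
        simp only [Pi.add_apply]
        exact integral_add hF hG
      map_smul' := fun c G => by
        rw [RingHom.id_apply, ← MemLp.toLp_const_smul]
        refine MemLp.toLp_congr _ _ ?_
        refine (ae_integral_eq_of_invariant hk (Lp.coeFn_smul c G)).trans ?_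
        refine Filter.Eventually.of_forall fun x => ?_
        simp only [Pi.smul_apply]
        exact integral_smul _ _ } 1 fun G => by
    rw [one_mul, LinearMap.coe_mk, AddHom.coe_mk, Lp.norm_toLp, Lp.norm_def]
    exact ENNReal.toReal_mono (Lp.eLpNorm_ne_top G)
      (eLpNorm_integral_le_of_invariant hk (Lp.memLp G))

lemma kernelOperator_toLp (hk : k ∘ₘ μ = μ) {g : E → ℝ} (hg : MemLp g 2 μ) :
    kernelOperator hk (hg.toLp g) =ᵐ[μ] fun x => ∫ y, g y ∂k x := by
  refine (MemLp.coeFn_toLp (memLp_integral_of_invariant hk (Lp.memLp (hg.toLp g)))).trans ?_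
  exact ae_integral_eq_of_invariant hk hg.coeFn_toLp

lemma isMarkovOperator_kernelOperator [TopologicalSpace E] [CompactSpace E]
    (hk : k ∘ₘ μ = μ) : IsMarkovOperator μ (kernelOperator hk) :=
  ⟨k, inferInstance, fun _ hg =>
    (ae_integrable_of_invariant hk hg).and (kernelOperator_toLp hk hg)⟩

end MarkovOperator

/-! ## The translation kernel -/

lemma jacobiInterval_half_add_nonneg (x : JacobiInterval) : 0 ≤ (1 + (x : ℝ)) / 2 := by
  have := x.2.1; linarith

lemma jacobiInterval_half_sub_nonneg (x : JacobiInterval) : 0 ≤ (1 - (x : ℝ)) / 2 := by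
  have := x.2.2; linarith

lemma sqrt_half_add_sq (x : JacobiInterval) : √((1 + (x : ℝ)) / 2) ^ 2 = (1 + x) / 2 :=
  Real.sq_sqrt (jacobiInterval_half_add_nonneg x)

lemma sqrt_half_sub_sq (x : JacobiInterval) : √((1 - (x : ℝ)) / 2) ^ 2 = (1 - x) / 2 :=
  Real.sq_sqrt (jacobiInterval_half_sub_nonneg x)

lemma sqrt_half_sq_add_sq (x : JacobiInterval) :
    √((1 + (x : ℝ)) / 2) ^ 2 + √((1 - (x : ℝ)) / 2) ^ 2 = 1 := by
  rw [sqrt_half_add_sq, sqrt_half_sub_sq]; ring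

/-- Sums of squares: (1 + Z)/2 = (ad + bes)² + b²e²(t - s²) and (1 - Z)/2 = (ae - bds)² + b²d²(1 -
s²) + b²e²(1 - t), where s² ≤ t ≤ 1. -/
lemma transVal_mem_Icc {a b d e : ℝ} (h1 : a ^ 2 + b ^ 2 = 1) (h2 : d ^ 2 + e ^ 2 = 1)
    (ω : JacobiInterval × JacobiInterval) : transVal a b d e ω ∈ Set.Icc (-1 : ℝ) 1 := by
  have hs := absc_sq_le ω
  have ht := radSq_le_one ω
  have hb : 0 ≤ (b * e) ^ 2 := sq_nonneg _
  unfold transVal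
  set s := absc ω
  set t := radSq ω
  constructor
  · nlinarith [sq_nonneg (a * d + b * e * s), mul_le_mul_of_nonneg_left hs hb]
  · have h3 : (a ^ 2 + b ^ 2) * (d ^ 2 + e ^ 2) = 1 := by rw [h1, h2, one_mul]
    have h4 : 0 ≤ (b * d) ^ 2 * (1 - s ^ 2) := mul_nonneg (sq_nonneg _) (by linarith)
    nlinarith [sq_nonneg (a * e - b * d * s), mul_le_mul_of_nonneg_left ht hb]

/-- The point of `[-1, 1]` over which the translation kernel averages. -/
def transPoint (z : (JacobiInterval × JacobiInterval) × (JacobiInterval × JacobiInterval)) :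
    JacobiInterval :=
  ⟨transVal (√((1 + (z.1.1 : ℝ)) / 2)) (√((1 - (z.1.1 : ℝ)) / 2)) (√((1 + (z.1.2 : ℝ)) / 2))
    (√((1 - (z.1.2 : ℝ)) / 2)) z.2,
    transVal_mem_Icc (sqrt_half_sq_add_sq z.1.1) (sqrt_half_sq_add_sq z.1.2) z.2⟩

lemma continuous_transPoint : Continuous transPoint := by
  refine Continuous.subtype_mk ?_ _
  unfold transVal
  fun_prop

/-- The translation kernel: the law of `Z` under `ρ ⊗ η`. -/
def transKernel (ρ η : Measure JacobiInterval) :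
    Kernel (JacobiInterval × JacobiInterval) JacobiInterval :=
  (Kernel.id ×ₖ Kernel.const _ (ρ.prod η)).map transPoint

section TransKernel

variable {ρ η : Measure JacobiInterval} [IsProbabilityMeasure ρ] [IsProbabilityMeasure η]

instance isMarkovKernel_transKernel : IsMarkovKernel (transKernel ρ η) :=
  Kernel.IsMarkovKernel.map _ continuous_transPoint.measurable

lemma transKernel_apply (x y : JacobiInterval) : transKernel ρ η (x, y) =
    (ρ.prod η).map fun ω => transPoint ((x, y), ω) := by
  rw [transKernel, Kernel.map_apply _ continuous_transPoint.measurable, Kernel.prod_apply,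
    Kernel.id_apply, Kernel.const_apply, Measure.dirac_prod,
    Measure.map_map continuous_transPoint.measurable measurable_prodMk_left]
  rfl

lemma integral_transKernel (x y : JacobiInterval) {F : JacobiInterval → ℝ} (hF : Continuous F) :
    ∫ z, F z ∂(transKernel ρ η (x, y)) = ∫ ω, F (transPoint ((x, y), ω)) ∂(ρ.prod η) := by
  rw [transKernel_apply, integral_map _ hF.measurable.aestronglyMeasurable]
  exact (continuous_transPoint.measurable.comp measurable_prodMk_left).aemeasurable

lemma ProductMoments.product_formula {p q : ℝ} (hp : 1 ≤ p) (hq : 1 ≤ q)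
    (hM : ProductMoments p q ρ η) (k : ℕ) (x y : JacobiInterval) :
    (jacobiPoly p q k).eval (x : ℝ) * (jacobiPoly p q k).eval (y : ℝ) /
        (jacobiPoly p q k).eval 1 =
      ∫ z : JacobiInterval, (jacobiPoly p q k).eval (z : ℝ) ∂(transKernel ρ η (x, y)) := by
  rw [integral_transKernel x y (by fun_prop)]
  have h := hM.product_formula_transVal hp hq (sqrt_half_sq_add_sq x) (sqrt_half_sq_add_sq y) k
  rw [sqrt_half_add_sq, sqrt_half_add_sq] at h
  rw [show 2 * ((1 + (x : ℝ)) / 2) - 1 = x by ring,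
    show 2 * ((1 + (y : ℝ)) / 2) - 1 = y by ring] at h
  exact h

lemma measure_comap_affine_preimage_eq_zero {N : Set JacobiInterval} {A K : ℝ} (hK : K ≠ 0)
    {S : Set JacobiInterval} (hS : ∀ c ∈ S, ∃ z ∈ N, (z : ℝ) = A + K * c)
    (hN : Measure.comap (Subtype.val : JacobiInterval → ℝ) volume N = 0) :
    Measure.comap (Subtype.val : JacobiInterval → ℝ) volume S = 0 := by
  rw [comap_subtype_coe_apply measurableSet_Icc] at hN ⊢
  have h1 : volume ((fun c : ℝ => K * c) ⁻¹' ((fun c : ℝ => A + c) ⁻¹'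
      ((Subtype.val : JacobiInterval → ℝ) '' N))) = 0 := by
    rw [Real.volume_preimage_mul_left hK, measure_preimage_add, hN, mul_zero]
  refine measure_mono_null ?_ h1
  rintro _ ⟨c, hc, rfl⟩
  obtain ⟨z, hz, hzc⟩ := hS c hc
  exact ⟨z, hz, hzc⟩

/-- By Fubini it suffices to fix ξ. Then Z = A + K c, and a nonconstant affine map pulls
Lebesgue-null sets back to null sets. -/
lemma transKernel_absolutelyContinuous
    (hρ : ρ ≪ Measure.comap (Subtype.val : JacobiInterval → ℝ) volume)
    (hη : η ≪ Measure.comap (Subtype.val : JacobiInterval → ℝ) volume) {μ : Measure JacobiInterval}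
    (hμ : Measure.comap (Subtype.val : JacobiInterval → ℝ) volume ≪ μ) {x y : JacobiInterval}
    (hx : (x : ℝ) ∈ Set.Ioo (-1 : ℝ) 1) (hy : (y : ℝ) ∈ Set.Ioo (-1 : ℝ) 1) :
    transKernel ρ η (x, y) ≪ μ := by
  refine Measure.AbsolutelyContinuous.mk fun N hN h0 => ?_
  have hm : Measurable fun ω => transPoint ((x, y), ω) :=
    continuous_transPoint.measurable.comp measurable_prodMk_left
  rw [transKernel_apply, Measure.map_apply hm hN, Measure.measure_prod_null (hm hN)]
  -- At ξ = -1 the radius is 0 and the slope K vanishes; this point is ρ-null.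
  have hne : ∀ᵐ ξ : JacobiInterval ∂ρ, (ξ : ℝ) ≠ -1 := by
    refine hρ.ae_le ?_
    rw [mem_ae_iff, comap_subtype_coe_apply measurableSet_Icc]
    refine measure_mono_null (t := {-1}) ?_ (by simp)
    rintro _ ⟨c, hc, rfl⟩
    simpa using hc
  filter_upwards [hne] with ξ hξ
  refine hη ?_
  have hpos (u : ℝ) (hu : 0 < u) : √(u / 2) ≠ 0 := (Real.sqrt_pos.2 (by linarith)).ne'
  have hξ' : -1 < (ξ : ℝ) := lt_of_le_of_ne ξ.2.1 hξ.symm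
  refine measure_comap_affine_preimage_eq_zero (N := N)
    (A := 2 * (√((1 + (x : ℝ)) / 2) ^ 2 * √((1 + (y : ℝ)) / 2) ^ 2) - 1 +
      2 * (√((1 - (x : ℝ)) / 2) ^ 2 * √((1 - (y : ℝ)) / 2) ^ 2) * ((1 + (ξ : ℝ)) / 2))
    (K := 4 * (√((1 + (x : ℝ)) / 2) * √((1 - (x : ℝ)) / 2) * √((1 + (y : ℝ)) / 2) *
      √((1 - (y : ℝ)) / 2)) * √((1 + (ξ : ℝ)) / 2)) ?_ ?_ (hμ h0)
  · have h1 := hpos (1 + x) (by linarith [hx.1])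
    have h2 := hpos (1 - x) (by linarith [hx.2])
    have h3 := hpos (1 + y) (by linarith [hy.1])
    have h4 := hpos (1 - y) (by linarith [hy.2])
    have h5 := hpos (1 + ξ) (by linarith)
    positivity
  · intro c hc
    refine ⟨_, hc, ?_⟩
    simp only [transPoint, transVal, radSq, absc]
    ring

end TransKernel

/-! ## Moments of the radial and angular measures -/

lemma radial_moments_jacobiMeasure {p q : ℝ} (hp : 0 < p) (hpq : p < q) (j : ℕ) :
    (j + p / 2) * ∫ x : JacobiInterval, ((1 + (x : ℝ)) / 2) ^ j * (1 - (1 + (x : ℝ)) / 2)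
        ∂jacobiMeasure p (q - p) =
      (q - p) / 2 * ∫ x : JacobiInterval, ((1 + (x : ℝ)) / 2) ^ (j + 1)
        ∂jacobiMeasure p (q - p) := by
  have := isProbabilityMeasure_jacobiMeasure hp (sub_pos.2 hpq)
  -- The test function is t^j with t = (1 + x)/2. As 1 - x² = 4t(1 - t), the integrand is twice the
  -- one wanted, hence the factor 1/2 below.
  have h := integral_jacobiMeasure_deriv hp (sub_pos.2 hpq) ((C (1 / 2) * (1 + X)) ^ j)
  rw [← sub_eq_zero, ← integral_const_mul, ← integral_const_mul,
    ← integral_sub (integrable_jacobiInterval (by fun_prop))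
      (integrable_jacobiInterval (by fun_prop))]
  have h' := congrArg (fun r => 1 / 2 * r) h
  simp only [← integral_const_mul, mul_zero] at h'
  rw [← h']
  congr 1
  ext x
  rcases j with _ | j
  · simp
    ring
  · simp [derivative_pow]
    ring

lemma angular_moments_jacobiMeasure {p : ℝ} (hp : 1 < p) (l : ℕ) :
    (l + 1) * ∫ x : JacobiInterval, (x : ℝ) ^ l ∂jacobiMeasure (p - 1) (p - 1) =
      (l + p) * ∫ x : JacobiInterval, (x : ℝ) ^ (l + 2) ∂jacobiMeasure (p - 1) (p - 1) := by
  have hp' : 0 < p - 1 := sub_pos.2 hp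
  have := isProbabilityMeasure_jacobiMeasure hp' hp'
  have h := integral_jacobiMeasure_deriv hp' hp' (X ^ (l + 1))
  rw [← sub_eq_zero, ← integral_const_mul, ← integral_const_mul,
    ← integral_sub (integrable_jacobiInterval (by fun_prop))
      (integrable_jacobiInterval (by fun_prop)), ← h]
  congr 1
  ext x
  simp
  ring

lemma angular_one_jacobiMeasure {p : ℝ} (hp : 1 < p) :
    ∫ x : JacobiInterval, (x : ℝ) ∂jacobiMeasure (p - 1) (p - 1) = 0 := by
  have hp' : 0 < p - 1 := sub_pos.2 hp
  have h := integral_jacobiMeasure_deriv hp' hp' 1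
  have e : ∀ x : JacobiInterval, (1 - (x : ℝ) ^ 2) * (derivative (1 : ℝ[X])).eval (x : ℝ) +
      ((p - 1 - (p - 1)) / 2 - (p - 1 + (p - 1)) / 2 * x) * (1 : ℝ[X]).eval (x : ℝ) =
      -(p - 1) * x := by
    intro x; simp; ring
  simp only [e, integral_const_mul] at h
  exact (mul_eq_zero.1 h).resolve_left (by linarith)

/-- The left end point `-1` of `[-1, 1]`. -/
def jacobiNegOne : JacobiInterval := ⟨-1, le_refl _, by norm_num⟩

/-- The symmetric measure with mass `1/2` at `1` and at `-1`. -/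
def twoPointMeasure : Measure JacobiInterval :=
  (2⁻¹ : ENNReal) • (Measure.dirac jacobiOne + Measure.dirac (jacobiNegOne))

lemma isProbabilityMeasure_twoPointMeasure : IsProbabilityMeasure twoPointMeasure := by
  refine ⟨?_⟩
  simp only [twoPointMeasure, Measure.smul_apply, Measure.add_apply, measure_univ, smul_eq_mul]
  rw [one_add_one_eq_two]
  exact ENNReal.inv_mul_cancel two_ne_zero ENNReal.ofNat_ne_top

lemma integral_twoPointMeasure {F : JacobiInterval → ℝ} (hF : Continuous F) :
    ∫ x, F x ∂twoPointMeasure = (F jacobiOne + F (jacobiNegOne)) / 2 := by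
  rw [twoPointMeasure, integral_smul_measure, integral_add_measure
    (integrable_jacobiInterval hF) (integrable_jacobiInterval hF), integral_dirac, integral_dirac]
  simp
  ring

lemma angular_moments_twoPointMeasure (l : ℕ) :
    ((l : ℝ) + 1) * ∫ x : JacobiInterval, (x : ℝ) ^ l ∂twoPointMeasure =
      (l + 1) * ∫ x : JacobiInterval, (x : ℝ) ^ (l + 2) ∂twoPointMeasure := by
  rw [integral_twoPointMeasure (by fun_prop), integral_twoPointMeasure (by fun_prop)]
  simp [jacobiOne, jacobiNegOne, pow_add]

lemma angular_one_twoPointMeasure : ∫ x : JacobiInterval, (x : ℝ) ∂twoPointMeasure = 0 := by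
  rw [integral_twoPointMeasure (by fun_prop)]
  simp [jacobiOne, jacobiNegOne]

/-- For p = 1 the weight of μ_{p-1,p-1} is no longer integrable and its limit, the two-point law,
takes over: there c² = 1 and both factors of the recursion are l + 1. -/
lemma exists_angular {p : ℝ} (hp : 1 ≤ p) : ∃ η : Measure JacobiInterval,
    IsProbabilityMeasure η ∧ (∫ x : JacobiInterval, (x : ℝ) ∂η = 0) ∧
      (∀ l : ℕ, (l + 1) * ∫ x : JacobiInterval, (x : ℝ) ^ l ∂η =
        (l + p) * ∫ x : JacobiInterval, (x : ℝ) ^ (l + 2) ∂η) ∧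
      (1 < p → η ≪ Measure.comap (Subtype.val : JacobiInterval → ℝ) volume) := by
  rcases hp.eq_or_lt with rfl | hp
  · exact ⟨twoPointMeasure, isProbabilityMeasure_twoPointMeasure, angular_one_twoPointMeasure,
      angular_moments_twoPointMeasure, fun h => absurd h (lt_irrefl _)⟩
  · have hp' : 0 < p - 1 := sub_pos.2 hp
    exact ⟨jacobiMeasure (p - 1) (p - 1), isProbabilityMeasure_jacobiMeasure hp' hp',
      angular_one_jacobiMeasure hp, angular_moments_jacobiMeasure hp,
      fun _ => jacobiMeasure_absolutelyContinuous_volume_comap _ _⟩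

/-- For p = q the law collapses to t = 1, where both sides of the recursion vanish. -/
lemma exists_radial {p q : ℝ} (hp : 0 < p) (hpq : p ≤ q) : ∃ ρ : Measure JacobiInterval,
    IsProbabilityMeasure ρ ∧
      (∀ j : ℕ, (j + p / 2) * ∫ x : JacobiInterval, ((1 + (x : ℝ)) / 2) ^ j *
        (1 - (1 + (x : ℝ)) / 2) ∂ρ =
          (q - p) / 2 * ∫ x : JacobiInterval, ((1 + (x : ℝ)) / 2) ^ (j + 1) ∂ρ) ∧
      (p < q → ρ ≪ Measure.comap (Subtype.val : JacobiInterval → ℝ) volume) := by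
  rcases hpq.eq_or_lt with rfl | hpq
  · refine ⟨Measure.dirac jacobiOne, inferInstance, fun j => ?_, fun h => absurd h (lt_irrefl _)⟩
    rw [integral_dirac, integral_dirac]
    simp [jacobiOne]
  · exact ⟨jacobiMeasure p (q - p), isProbabilityMeasure_jacobiMeasure hp (sub_pos.2 hpq),
      radial_moments_jacobiMeasure hp hpq,
      fun _ => jacobiMeasure_absolutelyContinuous_volume_comap _ _⟩

/-! ## Completeness of the Jacobi polynomials -/

section Completeness

variable {p q : ℝ}

lemma jacobiFun_apply (p q : ℝ) (k : ℕ) (x : JacobiInterval) :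
    jacobiFun p q k x = (jacobiPoly p q k).eval (x : ℝ) := rfl

lemma span_jacobiPoly (hp : 0 < p) (hq : 0 < q) :
    Submodule.span ℝ (Set.range (jacobiPoly p q)) = ⊤ := by
  let S : Polynomial.Sequence ℝ := ⟨jacobiPoly p q, fun i => by
    rw [degree_eq_natDegree (jacobiPoly_ne_zero hp hq i), natDegree_jacobiPoly hp hq]⟩
  exact S.span fun i => (leadingCoeff_ne_zero.2 (jacobiPoly_ne_zero hp hq i)).isUnit

lemma linearMap_eq_of_jacobiPoly (hp : 0 < p) (hq : 0 < q) {φ ψ : ℝ[X] →ₗ[ℝ] ℝ}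
    (h : ∀ i, φ (jacobiPoly p q i) = ψ (jacobiPoly p q i)) : φ = ψ := by
  refine LinearMap.ext_on (span_jacobiPoly hp hq) ?_
  rintro _ ⟨i, rfl⟩
  exact h i

lemma denseRange_toContinuousMapOn :
    DenseRange fun f : ℝ[X] => f.toContinuousMapOn (Set.Icc (-1 : ℝ) 1) := by
  have h := polynomialFunctions_closure_eq_top (-1) 1
  have h1 : Dense ((polynomialFunctions (Set.Icc (-1 : ℝ) 1) : Subalgebra ℝ _) :
      Set C(JacobiInterval, ℝ)) := by
    rw [dense_iff_closure_eq, ← Subalgebra.topologicalClosure_coe, h]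
    rfl
  rw [polynomialFunctions_coe] at h1
  exact h1

/-- By Weierstrass, polynomials are dense in C([-1, 1]), and integration is continuous for the
uniform norm. -/
lemma measure_eq_of_polyIntegral_eq {μ ν : Measure JacobiInterval} [IsFiniteMeasure μ]
    [IsFiniteMeasure ν] (h : polyIntegral μ = polyIntegral ν) : μ = ν := by
  have hc (μ : Measure JacobiInterval) [IsFiniteMeasure μ] :
      Continuous fun f : C(JacobiInterval, ℝ) => ∫ x, f x ∂μ := by
    have h1 := (continuous_integral (μ := μ) (G := ℝ)).comp
      (ContinuousMap.toLp (E := ℝ) 1 μ ℝ).continuous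
    refine h1.congr fun f => ?_
    exact integral_congr_ae (ContinuousMap.coeFn_toLp μ f)
  have heq := denseRange_toContinuousMapOn.equalizer (hc μ) (hc ν)
    (funext fun f => LinearMap.congr_fun h f)
  refine ext_of_forall_integral_eq_of_IsFiniteMeasure fun f => ?_
  exact congrFun heq f.toContinuousMap

lemma isUOB_jacobiFun (hp : 0 < p) (hq : 0 < q) : IsUOB (jacobiMeasure p q) (jacobiFun p q) where
  isProbabilityMeasure := isProbabilityMeasure_jacobiMeasure hp hq
  zero_eq_one := by
    have := isProbabilityMeasure_jacobiMeasure hp hq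
    ext x
    have h0 : jacobiMonic p q 0 = 1 := by rw [jacobiMonic]; simp
    rw [jacobiFun_apply, jacobiPoly, h0]
    simp
  orthonormal i j := by
    have := isProbabilityMeasure_jacobiMeasure hp hq
    rw [← polyIntegral_jacobiPoly_mul hp hq i j, polyIntegral_apply]
    simp [jacobiFun_apply]
  complete g hg h := by
    have := isProbabilityMeasure_jacobiMeasure hp hq
    set μ := jacobiMeasure p q
    -- The functional f ↦ ⟨g, f⟩ vanishes on every P_i, hence on all polynomials, which are dense in
    -- L²(μ).
    let φ : ℝ[X] →ₗ[ℝ] ℝ := ((innerSL ℝ (hg.toLp g)).comp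
      (ContinuousMap.toLp (E := ℝ) 2 μ ℝ)).toLinearMap ∘ₗ
        (toContinuousMapOnAlgHom (Set.Icc (-1 : ℝ) 1)).toLinearMap
    have hφ (f : ℝ[X]) : φ f = ∫ x : JacobiInterval, f.eval (x : ℝ) * g x ∂μ := by
      change inner ℝ (hg.toLp g) (ContinuousMap.toLp (E := ℝ) 2 μ ℝ (f.toContinuousMapOn _)) = _
      rw [L2.inner_def]
      refine integral_congr_ae ?_
      filter_upwards [hg.coeFn_toLp, ContinuousMap.coeFn_toLp (p := 2) (𝕜 := ℝ) μ
        (f.toContinuousMapOn (Set.Icc (-1 : ℝ) 1))] with x h1 h2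
      rw [h1, h2]
      simp
    have hφ0 : φ = 0 := linearMap_eq_of_jacobiPoly hp hq fun i => by
      rw [hφ, LinearMap.zero_apply]; exact h i
    have hd : DenseRange fun f : ℝ[X] => ContinuousMap.toLp (E := ℝ) 2 μ ℝ
        (f.toContinuousMapOn (Set.Icc (-1 : ℝ) 1)) :=
      (ContinuousMap.toLp_denseRange ℝ μ ℝ (by norm_num)).comp denseRange_toContinuousMapOn
        (ContinuousMap.toLp (E := ℝ) 2 μ ℝ).continuous
    have h0 : hg.toLp g = 0 := hd.eq_zero_of_inner_left ℝ fun f =>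
      LinearMap.congr_fun hφ0 f
    have h1 := hg.coeFn_toLp
    rw [h0] at h1
    exact h1.symm.trans (Lp.coeFn_zero ℝ 2 μ)

end Completeness

/-! ## The hypergroup property -/

section HypergroupProperty

/-- The translation kernel with its first argument fixed. -/
def transKernelAt (ρ η : Measure JacobiInterval) (x : JacobiInterval) :
    Kernel JacobiInterval JacobiInterval :=
  (transKernel ρ η).comap (Prod.mk x) measurable_prodMk_left

lemma transKernelAt_apply (ρ η : Measure JacobiInterval) (x y : JacobiInterval) :
    transKernelAt ρ η x y = transKernel ρ η (x, y) := Kernel.comap_apply _ _ _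

variable {ρ η : Measure JacobiInterval} [IsProbabilityMeasure ρ] [IsProbabilityMeasure η]
  {p q : ℝ}

instance isMarkovKernel_transKernelAt (x : JacobiInterval) :
    IsMarkovKernel (transKernelAt ρ η x) :=
  Kernel.IsMarkovKernel.comap _ measurable_prodMk_left

/-- Integrating the product formula in y against μ gives (P_i(x)/P_i(1)) ∫ P_i dμ. This is 1 for i =
0, and for i > 0 it is 0 = ∫ P_i dμ by orthogonality to P_0 = 1. -/
lemma ProductMoments.transKernelAt_comp (hp : 1 ≤ p) (hq : 1 ≤ q)
    (hM : ProductMoments p q ρ η) (x : JacobiInterval) :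
    transKernelAt ρ η x ∘ₘ jacobiMeasure p q = jacobiMeasure p q := by
  have hp0 : 0 < p := by linarith
  have hq0 : 0 < q := by linarith
  have := isProbabilityMeasure_jacobiMeasure hp0 hq0
  refine measure_eq_of_polyIntegral_eq (linearMap_eq_of_jacobiPoly hp0 hq0 fun i => ?_)
  have hint : Integrable (fun z : JacobiInterval => (jacobiPoly p q i).eval (z : ℝ))
      (transKernelAt ρ η x ∘ₘ jacobiMeasure p q) := integrable_jacobiInterval (by fun_prop)
  rw [polyIntegral_apply, polyIntegral_apply]
  rw [Measure.comp_eq_comp_const_apply] at hint ⊢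
  rw [Kernel.integral_comp hint, Kernel.const_apply]
  simp only [transKernelAt_apply, ← hM.product_formula hp hq]
  have hU := isUOB_jacobiFun hp0 hq0
  have h0 (y : JacobiInterval) : (jacobiPoly p q 0).eval (y : ℝ) = 1 := by
    rw [← jacobiFun_apply, hU.zero_eq_one]; rfl
  have h01 : (jacobiPoly p q 0).eval 1 = 1 := h0 jacobiOne
  rcases Nat.eq_zero_or_pos i with rfl | hi
  · simp [h0, h01]
  · have h1 : ∫ y : JacobiInterval, (jacobiPoly p q i).eval (y : ℝ) ∂jacobiMeasure p q = 0 := by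
      have h2 := hU.orthonormal i 0
      rw [if_neg hi.ne'] at h2
      simpa [jacobiFun_apply, h0] using h2
    rw [h1, integral_div, integral_const_mul, h1]
    simp

lemma ProductMoments.hasHypergroupProperty (hp : 1 ≤ p) (hq : 1 ≤ q)
    (hM : ProductMoments p q ρ η) :
    HasHypergroupProperty (jacobiMeasure p q) (jacobiFun p q) jacobiOne where
  isUOB := isUOB_jacobiFun (by linarith) (by linarith)
  ne_zero i := hM.eval_jacobiPoly_one_ne_zero hp hq i
  isMarkovSequence x := by
    have := isProbabilityMeasure_jacobiMeasure (by linarith : 0 < p) (by linarith : 0 < q)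
    have hk := hM.transKernelAt_comp hp hq x
    refine ⟨kernelOperator hk, isMarkovOperator_kernelOperator hk, fun i => ?_⟩
    have hi : MemLp (jacobiFun p q i) 2 (jacobiMeasure p q) :=
      (jacobiFun p q i).continuous.memLp_of_hasCompactSupport (HasCompactSupport.of_compactSpace _)
    refine ⟨hi, Lp.ext ?_⟩
    filter_upwards [kernelOperator_toLp hk hi, Lp.coeFn_smul (jacobiFun p q i x /
      jacobiFun p q i jacobiOne) (hi.toLp _), hi.coeFn_toLp] with y h1 h2 h3
    rw [h1, h2, Pi.smul_apply, h3, transKernelAt_apply, smul_eq_mul]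
    refine (hM.product_formula hp hq i x y).symm.trans ?_
    simp only [jacobiFun_apply, jacobiOne]
    ring

end HypergroupProperty

end

/-! ### Gasper's theorem -/

theorem mainTheorem8 (p q : ℝ) (hpq : (1 ≤ p ∧ p = q) ∨ (1 < p ∧ p < q)) :
    HasHypergroupProperty (jacobiMeasure p q) (jacobiFun p q) jacobiOne ∧
    ∃ m : Kernel (JacobiInterval × JacobiInterval) JacobiInterval,
      IsMarkovKernel m ∧
      (∀ (k : ℕ) (x y : JacobiInterval),
        (jacobiPoly p q k).eval (x : ℝ) * (jacobiPoly p q k).eval (y : ℝ) /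
            (jacobiPoly p q k).eval 1 =
          ∫ z : JacobiInterval, (jacobiPoly p q k).eval (z : ℝ) ∂(m (x, y))) ∧
      (p < q → ∀ x y : JacobiInterval,
        (x : ℝ) ∈ Set.Ioo (-1 : ℝ) 1 → (y : ℝ) ∈ Set.Ioo (-1 : ℝ) 1 →
          m (x, y) ≪ jacobiMeasure p q) := by
  have hp : 1 ≤ p := by rcases hpq with h | h <;> linarith [h.1]
  have hle : p ≤ q := by rcases hpq with h | h <;> linarith [h.2]
  have hq : 1 ≤ q := hp.trans hle
  have hp1 : p < q → 1 < p := fun h => by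
    rcases hpq with h' | h'
    · exact absurd h'.2 h.ne
    · exact h'.1
  obtain ⟨η, hη, hη1, hη2, hη3⟩ := exists_angular hp
  obtain ⟨ρ, hρ, hρ1, hρ2⟩ := exists_radial (by linarith : 0 < p) hle
  have hM : ProductMoments p q ρ η := ⟨hρ1, hη1, hη2⟩
  refine ⟨hM.hasHypergroupProperty hp hq, transKernel ρ η, inferInstance,
    hM.product_formula hp hq, fun h x y hx hy => ?_⟩
  exact transKernel_absolutelyContinuous (hρ2 h) (hη3 (hp1 h))
    (volume_comap_absolutelyContinuous_jacobiMeasure (by linarith) (by linarith)) hx hy
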